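/- Let $\mathbf{Heyt}_f$ be the category of finite Heyting algebras and Heyting homomorphisms. A modal algebra is a Boolean algebra $B$ with an operator $\Diamond$ preserving finite joins; put $\Box x=\neg\Diamond\neg x$. Let $\mathbf{Grz}_f$ be the category of finite modal algebras satisfying $x\wedge\Diamond x=x$, $\Diamond\Diamond x=\Diamond x$ and $\Box(\Box(x\to\Box x)\to x)\to x=\top$, with the Boolean homomorphisms preserving $\Diamond$. Let $\mathbf{Pos}_f$ be the category of finite posets and p-morphisms (monotone maps $f:P\to Q$ such that $f(p)\le q'$ implies $q'=f(p')$ for some $p'\ge p$). For a category $\mathcal C$, let $\mathrm{Pro}\,\mathcal C=(\mathrm{Ind}(\mathcal C^{op}))^{op}$, where $\mathrm{Ind}$ is the category of filtered colimits of representable presheaves. The forgetful functors $\mathrm{Pro}\,\mathbf{Grz}_f\to\mathbf{Set}$ and $\mathrm{Pro}\,\mathbf{Heyt}_f\to\mathbf{Set}$ send a formal cofiltered limit of finite algebras to the limit of their underlying sets. **Theorem.** Profinite Heyting algebras are monadic over $\mathbf{Set}$. More precisely: the functors $\mathbf{Pos}_f^{op}\to\mathbf{Heyt}_f$, $P\mapsto\mathrm{Up}(P)$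 (upsets), and $\mathbf{Pos}_f^{op}\to\mathbf{Grz}_f$, $P\mapsto(\mathcal P(P),\Diamond)$ with $\Diamond X=\{p\mid \exists p'\ge p,\ p'\in X\}$, both acting on morphisms by inverse image, are equivalences. There are an equivalence $E:\mathbf{Heyt}_f\simeq\mathbf{Grz}_f$ with $E(\mathrm{Up}(P))\cong(\mathcal P(P),\Diamond)$ naturally in $P$, and an equivalence $G:\mathrm{Pro}\,\mathbf{Heyt}_f\simeq\mathrm{Pro}\,\mathbf{Grz}_f$ extending $E$ (up to natural isomorphism), such that the composite of $G$ with the forgetful functor $\mathrm{Pro}\,\mathbf{Grz}_f\to\mathbf{Set}$ is monadic. This composite is not isomorphic to the forgetful functor $\mathrm{Pro}\,\mathbf{Heyt}_f\to\mathbf{Set}$. -/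

import Mathlib

open CategoryTheory CategoryTheory.Limits Opposite

universe v u

namespace ProfiniteHeyting

noncomputable section

/-! ### Pro-completions -/

/-- The Pro-completion of `C`, i.e. the opposite of the Ind-completion of `Cᵒᵖ`. An object of it
is (the formal dual of) a covariant set-valued functor on `C` which is a filtered colimit of
representable functors. -/
abbrev Pro (C : Type u) [Category.{v} C] : Type (max u (v + 1)) := (Ind Cᵒᵖ)ᵒᵖ

/-- The canonical embedding of `C` into its Pro-completion (the Yoneda embedding). -/
def Pro.embedding (C : Type u) [Category.{v} C] : C ⥤ Pro C :=
  (Ind.yoneda (C := Cᵒᵖ)).rightOp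

/-- Natural transformations from an ind-object to a set-valued functor form a small set. -/
theorem small_hom_of_isIndObject {D : Type u} [Category.{v} D] {A : Dᵒᵖ ⥤ Type v}
    (hA : IsIndObject A) (W : Dᵒᵖ ⥤ Type v) : Small.{v} (A ⟶ W) := by
  obtain ⟨⟨P⟩⟩ := hA
  let Φ : (A ⟶ W) → ∀ i : P.I, W.obj (op (P.F.obj i)) :=
    fun η i => yonedaEquiv (P.ι.app i ≫ η)
  refine small_of_injective (f := Φ) fun η θ h => ?_
  exact P.isColimit.hom_ext fun i => yonedaEquiv.injective (congrFun h i)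

/-- The natural extension of a set-valued functor `W` on `C` to the Pro-completion of `C`.
A pro-object, seen as a functor `X : C ⥤ Type v`, is sent to the set of natural transformations
from `X` to `W`. (If `X` is the formal cofiltered limit of objects `c i` of `C`, this is the set
`Hom (colim_i Hom (c i, -), W) = lim_i W (c i)`, by Yoneda.) These natural transformations form a
small set which is merely replaced by a copy of it in `Type v`. -/
def Pro.homFunctor {C : Type u} [Category.{v} C] (W : C ⥤ Type v) :
    Pro C ⥤ Type (max u v) :=
  (Ind.inclusion Cᵒᵖ).op ⋙ yoneda.obj (unopUnop C ⋙ W)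

instance {C : Type u} [Category.{v} C] (W : C ⥤ Type v) :
    FunctorToTypes.Small.{v} (Pro.homFunctor W) := fun X =>
  small_hom_of_isIndObject
    (((Ind.equivalence Cᵒᵖ).functor.obj X.unop).property) (unopUnop C ⋙ W)

/-- The functor `Pro.homFunctor W`, with its (small) values moved to `Type v`. -/
def Pro.extend {C : Type u} [Category.{v} C] (W : C ⥤ Type v) : Pro C ⥤ Type v :=
  FunctorToTypes.shrink.{v} (Pro.homFunctor W)

/-! ### Modal algebras -/

/-- A modal algebra is a Boolean algebra with an operator `◇` preserving finite joins. -/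
class ModalAlgebra (B : Type*) extends BooleanAlgebra B where
  /-- the possibility operator -/
  dia : B → B
  dia_sup : ∀ a b : B, dia (a ⊔ b) = dia a ⊔ dia b
  dia_bot : dia ⊥ = ⊥

open ModalAlgebra (dia)

/-- The necessity operator of a modal algebra. -/
def box {B : Type*} [ModalAlgebra B] (a : B) : B := (dia aᶜ)ᶜ

/-- The category of modal algebras. -/
structure ModAlg where
  /-- the underlying set -/
  carrier : Type u
  [str : ModalAlgebra carrier]

attribute [instance] ModAlg.str

/-- Morphisms of modal algebras: Boolean morphisms preserving `◇`. -/
@[ext]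
structure ModAlg.Hom (A B : ModAlg.{u}) where
  /-- the underlying Boolean morphism -/
  hom : BoundedLatticeHom A.carrier B.carrier
  map_dia : ∀ a, hom (dia a) = dia (hom a)

instance : Category ModAlg.{u} where
  Hom A B := ModAlg.Hom A B
  id A := ⟨BoundedLatticeHom.id A.carrier, fun _ => rfl⟩
  comp f g := ⟨g.hom.comp f.hom, fun a => by
    simp only [BoundedLatticeHom.comp_apply, f.map_dia, g.map_dia]⟩

/-- The forgetful functor from modal algebras to sets. -/
def ModAlg.forget : ModAlg.{u} ⥤ Type u where
  obj A := A.carrier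
  map f := TypeCat.ofHom f.hom

/-- The equations of the variety `Grz`: those of interior algebras and Grzegorczyk's axiom. -/
structure IsGrz (B : Type*) [ModalAlgebra B] : Prop where
  inf_dia : ∀ x : B, x ⊓ dia x = x
  dia_dia : ∀ x : B, dia (dia x) = dia x
  grz : ∀ x : B, box (box (x ⇨ box x) ⇨ x) ⇨ x = ⊤

/-- Finite `Grz`-algebras, as a property of modal algebras. -/
def isFinGrz : ObjectProperty ModAlg.{u} := fun B => Finite B.carrier ∧ IsGrz B.carrier

/-- The category of finite `Grz`-algebras. -/
abbrev FinGrz := isFinGrz.{u}.FullSubcategory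

/-- The forgetful functor from finite `Grz`-algebras to sets. -/
def FinGrz.forget : FinGrz.{u} ⥤ Type u := isFinGrz.ι ⋙ ModAlg.forget

/-! ### Heyting algebras -/

/-- Finite Heyting algebras, as a property of Heyting algebras. -/
def isFinHeyt : ObjectProperty HeytAlg.{u} := fun H => Finite H

/-- The category of finite Heyting algebras. -/
abbrev FinHeyt := isFinHeyt.{u}.FullSubcategory

/-- The forgetful functor from finite Heyting algebras to sets. -/
def FinHeyt.forget : FinHeyt.{u} ⥤ Type u := isFinHeyt.ι ⋙ CategoryTheory.forget HeytAlg.{u}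

/-! ### Kripke frames and their dual algebras -/

/-- A Kripke frame: a set with a binary relation. -/
structure KFrame where
  /-- the underlying set -/
  carrier : Type u
  /-- the accessibility relation -/
  rel : carrier → carrier → Prop

/-- p-morphisms of Kripke frames. -/
@[ext]
structure KFrame.Hom (P Q : KFrame.{u}) where
  /-- the underlying function -/
  toFun : P.carrier → Q.carrier
  stable : ∀ p p', P.rel p p' → Q.rel (toFun p) (toFun p')
  isOpen : ∀ p q', Q.rel (toFun p) q' → ∃ p', P.rel p p' ∧ toFun p' = q'

/-- The category of Kripke frames and p-morphisms. -/
instance : Category KFrame.{u} where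
  Hom P Q := KFrame.Hom P Q
  id P := ⟨id, fun _ _ h => h, fun _ q' h => ⟨q', h, rfl⟩⟩
  comp f g := ⟨g.toFun ∘ f.toFun, fun _ _ h => g.stable _ _ (f.stable _ _ h), fun p q' h => by
    obtain ⟨r, hr, rfl⟩ := g.isOpen _ _ h
    obtain ⟨s, hs, rfl⟩ := f.isOpen _ _ hr
    exact ⟨s, hs, rfl⟩⟩

/-- Finite posets, as a property of Kripke frames. -/
structure IsFinPoset (P : KFrame.{u}) : Prop where
  finite : Finite P.carrier
  refl : ∀ p, P.rel p p
  trans : ∀ p q r, P.rel p q → P.rel q r → P.rel p r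
  antisymm : ∀ p q, P.rel p q → P.rel q p → p = q

/-- The property of being a finite poset. -/
def isFinPoset : ObjectProperty KFrame.{u} := IsFinPoset

/-- The category of finite posets and p-morphisms. -/
abbrev FinPoset := isFinPoset.{u}.FullSubcategory

/-- The powerset of a Kripke frame, as a Boolean algebra. -/
def Pow (P : KFrame.{u}) : Type u := Set P.carrier

instance (P : KFrame.{u}) : BooleanAlgebra (Pow P) :=
  inferInstanceAs (BooleanAlgebra (Set P.carrier))

instance (P : KFrame.{u}) : Membership P.carrier (Pow P) :=
  inferInstanceAs (Membership P.carrier (Set P.carrier))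

@[ext]
theorem Pow.ext {P : KFrame.{u}} {X Y : Pow P} (h : ∀ p, p ∈ X ↔ p ∈ Y) : X = Y :=
  Set.ext h

/-- The Thomason dual of a Kripke frame: its powerset with
`◇ X = {p | ∃ p', p R p' and p' ∈ X}`. -/
instance (P : KFrame.{u}) : ModalAlgebra (Pow P) where
  dia X := ({p | ∃ p', P.rel p p' ∧ p' ∈ X} : Set P.carrier)
  dia_sup X Y := by
    ext p
    constructor
    · rintro ⟨q, h, hX | hY⟩
      · exact Or.inl ⟨q, h, hX⟩
      · exact Or.inr ⟨q, h, hY⟩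
    · rintro (⟨q, h, hX⟩ | ⟨q, h, hY⟩)
      · exact ⟨q, h, Or.inl hX⟩
      · exact ⟨q, h, Or.inr hY⟩
  dia_bot := by
    ext p
    constructor
    · rintro ⟨q, _, h⟩
      exact h
    · intro h
      exact h.elim

theorem mem_box {P : KFrame.{u}} (X : Pow P) (p : P.carrier) :
    p ∈ box X ↔ ∀ p', P.rel p p' → p' ∈ X := by
  change ¬ (∃ p', P.rel p p' ∧ ¬ p' ∈ X) ↔ _
  push Not
  rfl

theorem mem_himp {P : KFrame.{u}} (X Y : Pow P) (p : P.carrier) :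
    p ∈ (X ⇨ Y) ↔
      (p ∈ X → p ∈ Y) := by
  rw [himp_eq]
  change p ∈ Y ∨ ¬ p ∈ X ↔ _
  tauto

/-- The functor sending a Kripke frame to its Thomason dual, and a p-morphism to its inverse
image map. -/
def thomason : KFrame.{u}ᵒᵖ ⥤ ModAlg.{u} where
  obj P := ⟨Pow P.unop⟩
  map {P Q} f :=
    { hom :=
        { toFun := fun X => f.unop.toFun ⁻¹' X
          map_sup' := fun _ _ => rfl
          map_inf' := fun _ _ => rfl
          map_top' := rfl
          map_bot' := rfl }
      map_dia := fun X => by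
        apply Pow.ext
        intro q
        constructor
        · rintro ⟨p, h, hp⟩
          obtain ⟨q', hq', rfl⟩ := f.unop.isOpen _ _ h
          exact ⟨q', hq', hp⟩
        · rintro ⟨q', h, hq'⟩
          exact ⟨f.unop.toFun q', f.unop.stable _ _ h, hq'⟩ }

/-- The generated subframes of a Kripke frame (for a poset: its upsets). -/
@[ext]
structure GenSub (P : KFrame.{u}) where
  /-- the underlying subset -/
  carrier : Set P.carrier
  closed : ∀ p p', p ∈ carrier → P.rel p p' → p' ∈ carrier

theorem GenSub.closed_star {P : KFrame.{u}} (U : GenSub P) {p q : P.carrier}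
    (h : Relation.ReflTransGen P.rel p q) (hp : p ∈ U.carrier) : q ∈ U.carrier := by
  induction h with
  | refl => exact hp
  | tail _ h ih => exact U.closed _ _ ih h

/-- Generated subframes form a Heyting algebra under inclusion; the lattice operations are union
and intersection. (In a poset the reflexive-transitive closure of the relation is the relation
itself.) -/
instance (P : KFrame.{u}) : HeytingAlgebra (GenSub P) where
  le U V := U.carrier ⊆ V.carrier
  le_refl _ := subset_rfl
  le_trans _ _ _ h h' := h.trans h'
  le_antisymm _ _ h h' := GenSub.ext (h.antisymm h')
  sup U V := ⟨U.carrier ∪ V.carrier, fun p p' h hr =>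
    h.imp (fun h => U.closed p p' h hr) (fun h => V.closed p p' h hr)⟩
  inf U V := ⟨U.carrier ∩ V.carrier, fun p p' h hr =>
    ⟨U.closed p p' h.1 hr, V.closed p p' h.2 hr⟩⟩
  le_sup_left _ _ := Set.subset_union_left
  le_sup_right _ _ := Set.subset_union_right
  sup_le _ _ _ h h' := Set.union_subset h h'
  inf_le_left _ _ := Set.inter_subset_left
  inf_le_right _ _ := Set.inter_subset_right
  le_inf _ _ _ h h' := Set.subset_inter h h'
  top := ⟨Set.univ, fun _ _ _ _ => trivial⟩
  le_top _ := Set.subset_univ _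
  bot := ⟨∅, fun _ _ h _ => h⟩
  bot_le _ := Set.empty_subset _
  himp U V := ⟨{p | ∀ q, Relation.ReflTransGen P.rel p q → q ∈ U.carrier → q ∈ V.carrier},
    fun _ _ h hr q hq => h q (Relation.ReflTransGen.head hr hq)⟩
  le_himp_iff U V W := by
    constructor
    · rintro h p ⟨hU, hV⟩
      exact h hU p .refl hV
    · intro h p hU q hq hV
      exact h ⟨U.closed_star hq hU, hV⟩
  compl U := ⟨{p | ∀ q, Relation.ReflTransGen P.rel p q → q ∈ U.carrier → q ∈ (∅ : Set P.carrier)},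
    fun _ _ h hr q hq => h q (Relation.ReflTransGen.head hr hq)⟩
  himp_bot _ := rfl

theorem KFrame.Hom.map_star {P Q : KFrame.{u}} (f : KFrame.Hom P Q) {p q : P.carrier}
    (h : Relation.ReflTransGen P.rel p q) :
    Relation.ReflTransGen Q.rel (f.toFun p) (f.toFun q) := by
  induction h with
  | refl => exact .refl
  | tail _ h ih => exact ih.tail (f.stable _ _ h)

theorem KFrame.Hom.lift_star {P Q : KFrame.{u}} (f : KFrame.Hom P Q) {p : P.carrier} {q : Q.carrier}
    (h : Relation.ReflTransGen Q.rel (f.toFun p) q) :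
    ∃ p', Relation.ReflTransGen P.rel p p' ∧ f.toFun p' = q := by
  induction h with
  | refl => exact ⟨p, .refl, rfl⟩
  | tail _ h ih =>
    obtain ⟨r, hr, rfl⟩ := ih
    obtain ⟨s, hs, rfl⟩ := f.isOpen _ _ h
    exact ⟨s, hr.tail hs, rfl⟩

/-- The functor sending a Kripke frame to the Heyting algebra of its generated subframes, and a
p-morphism to its inverse image map. -/
def genSub : KFrame.{u}ᵒᵖ ⥤ HeytAlg.{u} where
  obj P := .of (GenSub P.unop)
  map {P Q} f := HeytAlg.ofHom
    { toFun := fun U => ⟨f.unop.toFun ⁻¹' U.carrier,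
        fun p p' h hr => U.closed _ _ h (f.unop.stable p p' hr)⟩
      map_sup' := fun _ _ => rfl
      map_inf' := fun _ _ => rfl
      map_bot' := rfl
      map_himp' := fun U V => by
        apply GenSub.ext
        ext p
        constructor
        · intro h q hq hU
          exact h _ (f.unop.map_star hq) hU
        · intro h q hq hU
          obtain ⟨r, hr, rfl⟩ := f.unop.lift_star hq
          exact h r hr hU }

theorem isGrz_pow {P : KFrame.{u}} (hP : IsFinPoset P) : IsGrz (Pow P) where
  inf_dia X := by
    ext p
    exact ⟨fun h => h.1, fun h => ⟨h, p, hP.refl p, h⟩⟩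
  dia_dia X := by
    ext p
    constructor
    · rintro ⟨q, h, r, h', hr⟩
      exact ⟨r, hP.trans _ _ _ h h', hr⟩
    · rintro ⟨q, h, hq⟩
      exact ⟨q, h, q, hP.refl q, hq⟩
  grz X := by
    rw [himp_eq_top_iff]
    intro p hp
    replace hp := (mem_box _ p).1 hp
    by_contra hpX
    have := hP.finite
    let _ : PartialOrder P.carrier :=
      { le := P.rel, le_refl := hP.refl, le_trans := hP.trans, le_antisymm := hP.antisymm }
    obtain ⟨q, hq⟩ := Set.Finite.exists_maximal
      (Set.toFinite {q : P.carrier | P.rel p q ∧ q ∉ X}) ⟨p, hP.refl p, hpX⟩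
    have h1 := hp q hq.1.1
    rw [mem_himp] at h1
    refine hq.1.2 (h1 ?_)
    rw [mem_box]
    intro r hqr
    rw [mem_himp]
    intro hrX
    rw [mem_box]
    intro s hrs
    by_contra hsX
    have hqs : P.rel q s := hP.trans _ _ _ hqr hrs
    have hsq : P.rel s q := hq.2 ⟨hP.trans _ _ _ hq.1.1 hqs, hsX⟩ hqs
    have : q = r := hP.antisymm _ _ hqr (hP.trans _ _ _ hrs hsq)
    exact hq.1.2 (this ▸ hrX)

/-- The contravariant functor from finite posets to finite `Grz`-algebras (powersets). -/
def FinPoset.powerset : FinPoset.{u}ᵒᵖ ⥤ FinGrz.{u} :=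
  isFinGrz.lift (isFinPoset.ι.op ⋙ thomason) fun P =>
    have := P.unop.property.finite
    ⟨inferInstanceAs (Finite (Set P.unop.obj.carrier)), isGrz_pow P.unop.property⟩

/-- The contravariant functor from finite posets to finite Heyting algebras (upsets). -/
def FinPoset.upsets : FinPoset.{u}ᵒᵖ ⥤ FinHeyt.{u} :=
  isFinHeyt.lift (isFinPoset.ι.op ⋙ genSub) fun P =>
    have := P.unop.property.finite
    Finite.of_injective (fun U : GenSub P.unop.obj => U.carrier) fun _ _ h => GenSub.ext h

end

end ProfiniteHeyting

-- Both finite dualities rest on the fact that a homomorphism out of Up(P) or 𝒫(P), read at one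
-- point q, gives a prime filter of a finite distributive lattice, hence a point of P.
-- Join-irreducibles and atoms give essential surjectivity; Grzegorczyk's axiom makes the relation
-- on atoms antisymmetric. E is the composite of the two dualities and G its extension to
-- pro-objects.
--
-- By duality Pro Grz_f is opposite to Ind Pos_f, and the forgetful functor becomes A ↦ Hom(A, Ω)
-- with Ω = `powPresheaf`. Monadicity is then an analogue of Paré's theorem on power objects, proved
-- by the monadicity theorem for reflexive coequalizers. Ind-objects are treated as flat presheaves:
-- finitely many elements and equations live in a single representable, so questions about them
-- reduce to coproducts, coequalizers and surjections of finite posets.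
--
-- A map A ⟶ Ω is a predicate on points of elements of A, invariant under p-morphisms. Conditions on
-- the germ at p (the restriction to ↑p) are often invariant, because a p-morphism restricts to a
-- surjection ↑p → ↑f(p), and flat presheaves restrict injectively along surjections.
--
-- Three facts give monadicity. The presheaf P ↦ (P → Set X) is an ind-object representing X-indexed
-- families of maps to Ω, which yields the left adjoint; its flatness uses that coequalizers in
-- Pos_f are computed on sets (`coeqSetoid_antisymm`). Maps to Ω separate points and detect images,
-- so Hom(-, Ω) reflects isomorphisms (`isIso_of_bijective`). Direct images along split
-- monomorphisms satisfy a Beck–Chevalley identity (`comp_directImage'`), so coreflexive equalizers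
-- become split coequalizers.
--
-- The two forgetful functors differ already on the two-element chain: four subsets, three upsets.

universe u'

namespace ProfiniteHeyting

open ModalAlgebra (dia)

/-! ### Finite posets -/

namespace FinPoset

/-- The morphism of finite posets given by a p-morphism. -/
def homMk {P Q : FinPoset.{u}} (f : P.obj.carrier → Q.obj.carrier)
    (stable : ∀ p p', P.obj.rel p p' → Q.obj.rel (f p) (f p'))
    (isOpen : ∀ p q', Q.obj.rel (f p) q' → ∃ p', P.obj.rel p p' ∧ f p' = q') : P ⟶ Q :=
  ObjectProperty.homMk (KFrame.Hom.mk f stable isOpen)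

/-- The underlying function of a morphism of finite posets. -/
def fn {P Q : FinPoset.{u}} (f : P ⟶ Q) : P.obj.carrier → Q.obj.carrier := f.hom.toFun

@[simp]
theorem fn_comp {P Q R : FinPoset.{u}} (f : P ⟶ Q) (g : Q ⟶ R) : fn (f ≫ g) = fn g ∘ fn f := rfl

theorem fn_stable {P Q : FinPoset.{u}} (f : P ⟶ Q) {p p' : P.obj.carrier} (h : P.obj.rel p p') :
    Q.obj.rel (fn f p) (fn f p') := f.hom.stable _ _ h

theorem fn_open {P Q : FinPoset.{u}} (f : P ⟶ Q) {p : P.obj.carrier} {q : Q.obj.carrier}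
    (h : Q.obj.rel (fn f p) q) : ∃ p', P.obj.rel p p' ∧ fn f p' = q := f.hom.isOpen _ _ h

theorem hom_ext {P Q : FinPoset.{u}} {f g : P ⟶ Q} (h : ∀ p, fn f p = fn g p) : f = g :=
  ObjectProperty.hom_ext _ (KFrame.Hom.ext (funext h))

theorem refl (P : FinPoset.{u}) (p : P.obj.carrier) : P.obj.rel p p := P.property.refl p

theorem trans {P : FinPoset.{u}} {p q r : P.obj.carrier} (h : P.obj.rel p q) (h' : P.obj.rel q r) :
    P.obj.rel p r := P.property.trans _ _ _ h h'

theorem antisymm {P : FinPoset.{u}} {p q : P.obj.carrier} (h : P.obj.rel p q)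
    (h' : P.obj.rel q p) : p = q := P.property.antisymm _ _ h h'

theorem finite (P : FinPoset.{u}) : Finite P.obj.carrier := P.property.finite

theorem rel_of_star {P : FinPoset.{u}} {p q : P.obj.carrier}
    (h : Relation.ReflTransGen P.obj.rel p q) : P.obj.rel p q := by
  induction h with
  | refl => exact P.refl p
  | tail _ h ih => exact trans ih h

theorem exists_maximal {P : FinPoset.{u}} {S : P.obj.carrier → Prop} {p : P.obj.carrier}
    (hp : S p) : ∃ m, S m ∧ ∀ q, P.obj.rel m q → S q → q = m := by
  have := P.finite
  let _ : PartialOrder P.obj.carrier :=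
    { le := P.obj.rel, le_refl := P.refl, le_trans := fun _ _ _ => trans,
      le_antisymm := fun _ _ => antisymm }
  obtain ⟨m, hm⟩ := Set.Finite.exists_maximal (Set.toFinite {q | S q}) ⟨p, hp⟩
  exact ⟨m, hm.1, fun q hq hS => antisymm (hm.2 hS hq) hq⟩

end FinPoset

/-! ### Duality for finite Heyting algebras -/

theorem GenSub.le_iff {P : KFrame.{u}} {U V : GenSub P} :
    U ≤ V ↔ ∀ p, p ∈ U.carrier → p ∈ V.carrier := Iff.rfl

/-- The upset generated by a point. -/
def FinPoset.principal {P : FinPoset.{u}} (p : P.obj.carrier) : GenSub P.obj :=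
  ⟨{q | P.obj.rel p q}, fun _ _ => FinPoset.trans⟩

theorem FinPoset.principal_le {P : FinPoset.{u}} {p : P.obj.carrier} {U : GenSub P.obj}
    (h : p ∈ U.carrier) : FinPoset.principal p ≤ U := fun _ hq => U.closed _ _ h hq

/-- U is a finite join of principal upsets, and membership of q in g(-) distributes over finite
joins. -/
theorem FinPoset.exists_principal {P : FinPoset.{u}} {Q : KFrame.{u}}
    (g : HeytingHom (GenSub P.obj) (GenSub Q)) (q : Q.carrier) (U : GenSub P.obj)
    (h : q ∈ (g U).carrier) : ∃ p ∈ U.carrier, q ∈ (g (FinPoset.principal p)).carrier := by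
  classical
  have := P.finite
  have := Fintype.ofFinite P.obj.carrier
  by_contra! H
  have key : ∀ S : Finset P.obj.carrier, (∀ p ∈ S, p ∈ U.carrier) →
      q ∉ (g (S.sup FinPoset.principal)).carrier := by
    intro S
    induction S using Finset.induction_on with
    | empty => intro _; rw [Finset.sup_empty, map_bot]; exact id
    | insert a S _ ih =>
      intro hS
      rw [Finset.sup_insert, map_sup]
      rintro (h | h)
      · exact H a (hS a (by simp)) h
      · exact ih (fun p hp => hS p (by simp [hp])) h
  refine key (Finset.univ.filter (· ∈ U.carrier)) (by simp) ?_
  refine GenSub.le_iff.1 (OrderHomClass.mono g ?_) q h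
  intro p hp
  exact (Finset.le_sup (f := FinPoset.principal) (by simpa using hp) :
    FinPoset.principal p ≤ _) (P.refl p)

/-- The upsets U with q ∈ g U form a prime filter. Its least element is principal, generated by a
maximal p with q ∈ g(↑p). -/
theorem FinPoset.exists_point {P : FinPoset.{u}} {Q : KFrame.{u}}
    (g : HeytingHom (GenSub P.obj) (GenSub Q)) (q : Q.carrier) :
    ∃ p, ∀ U, p ∈ U.carrier ↔ q ∈ (g U).carrier := by
  obtain ⟨p₀, -, hp₀⟩ := FinPoset.exists_principal g q ⊤ (by rw [map_top]; trivial)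
  obtain ⟨p, hp, hmax⟩ := FinPoset.exists_maximal
    (S := fun p => q ∈ (g (FinPoset.principal p)).carrier) hp₀
  refine ⟨p, fun U => ⟨fun h => ?_, fun h => ?_⟩⟩
  · exact GenSub.le_iff.1 (OrderHomClass.mono g (FinPoset.principal_le h)) q hp
  · obtain ⟨p', hp', hq⟩ := FinPoset.exists_principal g q (U ⊓ FinPoset.principal p)
      (by rw [map_inf]; exact ⟨h, hp⟩)
    rw [← hmax p' hp'.2 hq]
    exact hp'.1

instance : FinPoset.upsets.{u}.Faithful where
  map_injective {P Q f g} h := by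
    apply Quiver.Hom.unop_inj
    refine FinPoset.hom_ext fun q => ?_
    have h' : ∀ U : GenSub P.unop.obj, FinPoset.fn f.unop q ∈ U.carrier ↔
        FinPoset.fn g.unop q ∈ U.carrier := fun U => by
      have := congrArg (fun k => (k.hom U : GenSub Q.unop.obj).carrier) h
      exact iff_of_eq (congrFun this q)
    exact FinPoset.antisymm ((h' (FinPoset.principal _)).1 (P.unop.refl _))
      ((h' (FinPoset.principal _)).2 (P.unop.refl _))

instance : FinPoset.upsets.{u}.Full where
  map_surjective {P Q} g := by
    let g' : HeytingHom (GenSub P.unop.obj) (GenSub Q.unop.obj) := g.hom.hom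
    choose f hf using FinPoset.exists_point g'
    refine ⟨(FinPoset.homMk (P := Q.unop) (Q := P.unop) f ?_ ?_).op, ?_⟩
    · intro p p' h
      refine (hf p' (FinPoset.principal _)).2 (GenSub.closed _ _ _ ?_ h)
      exact (hf p (FinPoset.principal _)).1 (P.unop.refl _)
    · intro q p' h
      by_contra! H
      -- Openness is where implication is needed: if no q' above q maps to p', then q lies in the
      -- image of ↑p' ⇨ (↑p' minus p'), so f q lies in that implication, which fails at p'.
      let V : GenSub P.unop.obj := ⟨{r | P.unop.obj.rel p' r ∧ r ≠ p'}, fun r r' h h' =>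
        ⟨FinPoset.trans h.1 h', by rintro rfl; exact h.2 (FinPoset.antisymm h' h.1)⟩⟩
      have h1 : q ∈ (g' (FinPoset.principal p' ⇨ V)).carrier := by
        rw [map_himp]
        intro q' hq' hp'
        refine (hf q' V).1 ⟨(hf q' _).2 hp', H q' (FinPoset.rel_of_star hq')⟩
      exact ((hf q _).2 h1 p' (.single h) (P.unop.refl p')).2 rfl
    · apply ObjectProperty.hom_ext
      apply HeytAlg.hom_ext
      ext U
      apply GenSub.ext
      ext q
      exact hf q U

instance : FinPoset.upsets.{u}.EssSurj where
  mem_essImage H := by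
    classical
    have : Finite H.obj := H.property
    have := Fintype.ofFinite H.obj
    -- Birkhoff duality with the order on join-irreducibles reversed, so that upsets of P are lower
    -- sets of join-irreducibles.
    let P : FinPoset.{u} := ⟨⟨{a : H.obj // SupIrred a}, fun a b => b ≤ a⟩,
      { finite := inferInstanceAs (Finite {a : H.obj // SupIrred a})
        refl := fun p => le_refl (α := {a : H.obj // SupIrred a}) p
        trans := fun p q r h h' => le_trans (α := {a : H.obj // SupIrred a}) h' h
        antisymm := fun p q h h' => le_antisymm (α := {a : H.obj // SupIrred a}) h' h }⟩
    let e : GenSub P.obj ≃o LowerSet {a : H.obj // SupIrred a} :=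
      { toFun := fun U => ⟨U.carrier, fun a b h h' => U.closed a b h' h⟩
        invFun := fun L => ⟨L.carrier, fun a b h h' => L.lower h' h⟩
        left_inv := fun _ => rfl
        right_inv := fun _ => rfl
        map_rel_iff' := Iff.rfl }
    refine ⟨op P, ⟨isFinHeyt.isoMk ?_⟩⟩
    exact HeytAlg.Iso.mk (e.trans OrderIso.lowerSetSupIrred.symm)

instance : FinPoset.upsets.{u}.IsEquivalence where

/-! ### Duality for finite Grzegorczyk algebras -/

theorem Pow.le_iff {P : KFrame.{u}} {X Y : Pow P} : X ≤ Y ↔ ∀ p, p ∈ X → p ∈ Y := Iff.rfl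

/-- The singletons, as elements of the powerset. -/
def Pow.single {P : KFrame.{u}} (p : P.carrier) : Pow P := ({p} : Set P.carrier)

theorem Pow.mem_dia {P : KFrame.{u}} {X : Pow P} {p : P.carrier} :
    p ∈ dia X ↔ ∃ p', P.rel p p' ∧ p' ∈ X := Iff.rfl

/-- The sets X with q ∈ g X form an ultrafilter on a finite set, hence a principal one. -/
theorem Pow.exists_point {P Q : KFrame.{u}} [Finite P.carrier]
    (g : BoundedLatticeHom (Pow P) (Pow Q)) (q : Q.carrier) :
    ∃ p, ∀ X, p ∈ X ↔ q ∈ g X := by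
  classical
  have := Fintype.ofFinite P.carrier
  have mono {X Y : Pow P} (h : X ≤ Y) : q ∈ g X → q ∈ g Y :=
    Pow.le_iff.1 (OrderHomClass.mono g h) q
  obtain ⟨p, hp⟩ : ∃ p, q ∈ g (Pow.single p) := by
    by_contra! H
    have key : ∀ S : Finset P.carrier, q ∉ g (S.sup Pow.single) := by
      intro S
      induction S using Finset.induction_on with
      | empty => rw [Finset.sup_empty, map_bot]; exact id
      | insert a S _ ih =>
        rw [Finset.sup_insert, map_sup]
        rintro (h | h)
        · exact H a h
        · exact ih h
    refine key Finset.univ (mono (X := ⊤) ?_ (by rw [map_top]; trivial))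
    exact fun p _ => (Finset.le_sup (f := Pow.single) (Finset.mem_univ p) :
      Pow.single p ≤ _) rfl
  have single_le {p : P.carrier} {X : Pow P} (h : p ∈ X) : Pow.single p ≤ X := by
    rintro _ rfl
    exact h
  refine ⟨p, fun X => ⟨fun h => mono (single_le h) hp, fun h => ?_⟩⟩
  by_contra hX
  have h1 : q ∈ g (X ⊓ Pow.single p) := by
    rw [map_inf]
    exact ⟨h, hp⟩
  have h2 : X ⊓ Pow.single p = ⊥ := by
    ext r
    constructor
    · rintro ⟨h, rfl⟩
      exact hX h
    · exact fun h => h.elim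
  rw [h2, map_bot] at h1
  exact h1

instance : FinPoset.powerset.{u}.Faithful where
  map_injective {P Q f g} h := by
    apply Quiver.Hom.unop_inj
    refine FinPoset.hom_ext fun q => ?_
    have := congrArg (fun k => (k.hom.hom (Pow.single (FinPoset.fn g.unop q)) : Pow Q.unop.obj)) h
    exact (iff_of_eq (congrFun this q)).2 rfl

instance : FinPoset.powerset.{u}.Full where
  map_surjective {P Q} g := by
    let g' : ModAlg.Hom ⟨Pow P.unop.obj⟩ ⟨Pow Q.unop.obj⟩ := g.hom
    have := P.unop.finite
    choose f hf using Pow.exists_point g'.hom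
    refine ⟨(FinPoset.homMk (P := Q.unop) (Q := P.unop) f ?_ ?_).op, ?_⟩
    · intro p p' h
      have h1 : p ∈ g'.hom (dia (Pow.single (f p'))) := by
        rw [g'.map_dia]
        exact ⟨p', h, (hf p' _).1 rfl⟩
      obtain ⟨r, hr, rfl⟩ := (hf p _).2 h1
      exact hr
    · intro q p' h
      have h1 : q ∈ g'.hom (dia (Pow.single p')) := (hf q _).1 ⟨p', h, rfl⟩
      rw [g'.map_dia] at h1
      obtain ⟨q', hq', h2⟩ := h1
      exact ⟨q', hq', (hf q' _).2 h2⟩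
    · apply ObjectProperty.hom_ext
      apply ModAlg.Hom.ext
      ext X
      apply Pow.ext
      exact fun q => hf q X

/-- The isomorphism of modal algebras given by an order isomorphism preserving `◇`. -/
def ModAlg.isoMk {A B : ModAlg.{u}} (e : A.carrier ≃o B.carrier)
    (he : ∀ a, e (dia a) = dia (e a)) : A ≅ B where
  hom := ⟨(e : BoundedLatticeHom A.carrier B.carrier), he⟩
  inv := ⟨(e.symm : BoundedLatticeHom B.carrier A.carrier), fun b => by
    apply e.injective
    change e (e.symm (dia b)) = e (dia (e.symm b))
    rw [he, e.apply_symm_apply, e.apply_symm_apply]⟩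
  hom_inv_id := by
    apply ModAlg.Hom.ext
    ext a
    exact e.symm_apply_apply a
  inv_hom_id := by
    apply ModAlg.Hom.ext
    ext a
    exact e.apply_symm_apply a

theorem ModalAlgebra.dia_mono {B : Type*} [ModalAlgebra B] : Monotone (dia : B → B) := by
  intro a b h
  rw [← sup_eq_right.2 h, ModalAlgebra.dia_sup]
  exact le_sup_left

theorem IsGrz.of_iso {A B : ModAlg.{u}} (e : A ≅ B) (hA : IsGrz A.carrier) : IsGrz B.carrier := by
  have surj (b : B.carrier) : ∃ a, e.hom.hom a = b :=
    ⟨e.inv.hom b, congrArg (fun k : B ⟶ B => k.hom b) e.inv_hom_id⟩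
  have map_box (a : A.carrier) : e.hom.hom (box a) = box (e.hom.hom a) := by
    simp only [box, map_compl', e.hom.map_dia]
  refine ⟨fun x => ?_, fun x => ?_, fun x => ?_⟩ <;> obtain ⟨a, rfl⟩ := surj x
  · rw [← e.hom.map_dia, ← map_inf, hA.inf_dia]
  · rw [← e.hom.map_dia, ← e.hom.map_dia, hA.dia_dia]
  · have := congrArg e.hom.hom (hA.grz a)
    simpa only [himp_eq, map_sup, map_compl', map_box, map_top] using this

theorem IsGrz.isFinPoset {P : KFrame.{u}} [hfin : Finite P.carrier] (h : IsGrz (Pow P)) :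
    IsFinPoset P where
  finite := hfin
  refl p := by
    have h1 : p ∈ Pow.single p ⊓ dia (Pow.single p) := by rw [h.inf_dia]; rfl
    obtain ⟨q, hq, rfl⟩ := h1.2
    exact hq
  trans p q r hpq hqr := by
    have h1 : p ∈ dia (dia (Pow.single r)) := ⟨q, hpq, r, hqr, rfl⟩
    rw [h.dia_dia] at h1
    obtain ⟨s, hs, rfl⟩ := h1
    exact hs
  antisymm p q hpq hqp := by
    by_contra hne
    -- In a two-element cycle p, q the axiom fails at p for the complement of p: at p the premise `X
    -- ⇨ box X` would put q in `box X`, although q sees p.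
    have h1 := h.grz (Pow.single p)ᶜ
    rw [himp_eq_top_iff, Pow.le_iff] at h1
    refine h1 p ?_ rfl
    rw [mem_box]
    intro r _
    rw [mem_himp, mem_box]
    rintro hr rfl
    have h2 := hr q hpq
    rw [mem_himp, mem_box] at h2
    exact h2 (fun h => hne h.symm) r hqp rfl

/-- As `◇` preserves finite joins, it is determined by the relation a ≤ ◇b between atoms. No axiom
of `Grz` enters here. -/
theorem ModAlg.exists_iso_pow (B : ModAlg.{u}) [Finite B.carrier] :
    ∃ P : KFrame.{u}, Finite P.carrier ∧ Nonempty ((⟨Pow P⟩ : ModAlg.{u}) ≅ B) := by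
  classical
  have := Fintype.ofFinite B.carrier
  let P : KFrame.{u} := ⟨{a : B.carrier // IsAtom a}, fun a b => a.1 ≤ dia b.1⟩
  have hP : Finite P.carrier := inferInstanceAs (Finite {a : B.carrier // IsAtom a})
  have := Fintype.ofFinite P.carrier
  have atom_le_sup {a b c : B.carrier} (ha : IsAtom a) (h : a ≤ b ⊔ c) : a ≤ b ∨ a ≤ c := by
    by_contra! H
    have h1 := ha.not_le_iff_disjoint.1 H.1
    have h2 := ha.not_le_iff_disjoint.1 H.2
    exact ha.1 ((h1.sup_right h2).eq_bot_of_le h)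
  let j (S : Finset P.carrier) : B.carrier := S.sup (fun a => a.1)
  have le_dia_j (a : P.carrier) (S : Finset P.carrier) :
      a.1 ≤ dia (j S) ↔ ∃ b ∈ S, a.1 ≤ dia b.1 := by
    constructor
    · induction S using Finset.induction_on with
      | empty =>
        intro h
        simp only [j, Finset.sup_empty, ModalAlgebra.dia_bot, le_bot_iff] at h
        exact (a.2.1 h).elim
      | insert b S _ ih =>
        intro h
        simp only [j, Finset.sup_insert, ModalAlgebra.dia_sup] at h
        rcases atom_le_sup a.2 h with h | h
        · exact ⟨b, by simp, h⟩
        · obtain ⟨c, hc, h⟩ := ih h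
          exact ⟨c, by simp [hc], h⟩
    · rintro ⟨b, hb, h⟩
      exact h.trans (ModalAlgebra.dia_mono (Finset.le_sup (f := fun a => a.1) hb))
  let e : B.carrier ≃o Pow P := by
    letI : CompleteAtomicBooleanAlgebra B.carrier :=
      Fintype.toCompleteAtomicBooleanAlgebra B.carrier
    exact CompleteAtomicBooleanAlgebra.toSetOfIsAtom
  have mem_e (x : B.carrier) (a : P.carrier) : a ∈ e x ↔ a.1 ≤ x := Iff.rfl
  refine ⟨P, hP, ⟨(ModAlg.isoMk (A := B) (B := ⟨Pow P⟩) e fun x => ?_).symm⟩⟩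
  have hx : x = j (Finset.univ.filter (· ∈ e x)) := by
    apply e.injective
    ext a
    rw [mem_e, mem_e]
    constructor
    · intro h
      exact Finset.le_sup (f := fun a : P.carrier => a.1) (by simpa [mem_e] using h)
    · intro h
      refine h.trans (Finset.sup_le fun b hb => ?_)
      simpa [mem_e] using hb
  ext a
  rw [mem_e]
  conv_lhs => rw [hx]
  rw [le_dia_j, Pow.mem_dia]
  simp only [Finset.mem_filter, Finset.mem_univ, true_and]
  exact exists_congr fun b => and_comm

instance : FinPoset.powerset.{u}.EssSurj where
  mem_essImage B := by
    have : Finite B.obj.carrier := B.property.1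
    obtain ⟨P, hP, ⟨e⟩⟩ := ModAlg.exists_iso_pow B.obj
    exact ⟨op ⟨P, (IsGrz.of_iso e.symm B.property.2).isFinPoset⟩, ⟨isFinGrz.isoMk e⟩⟩

instance : FinPoset.powerset.{u}.IsEquivalence where

/-! ### Constructions with finite posets -/

namespace FinPoset

/-- The disjoint union of two finite posets. -/
def coprod (P Q : FinPoset.{u}) : FinPoset.{u} where
  obj := ⟨P.obj.carrier ⊕ Q.obj.carrier, Sum.LiftRel P.obj.rel Q.obj.rel⟩
  property :=
    { finite := by
        have := P.finite
        have := Q.finite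
        exact inferInstanceAs (Finite (P.obj.carrier ⊕ Q.obj.carrier))
      refl := by
        rintro (p | q)
        · exact .inl (P.refl p)
        · exact .inr (Q.refl q)
      trans := by
        rintro _ _ _ (h | h) (h' | h')
        · exact .inl (trans h h')
        · exact .inr (trans h h')
      antisymm := by
        rintro _ _ (h | h) (h' | h')
        · exact congrArg Sum.inl (antisymm h h')
        · exact congrArg Sum.inr (antisymm h h') }

/-- The first inclusion into a disjoint union. -/
def inl (P Q : FinPoset.{u}) : P ⟶ coprod P Q :=
  homMk (Q := coprod P Q) Sum.inl (fun _ _ h => .inl h) (by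
    rintro p _ (h | h)
    exact ⟨_, h, rfl⟩)

/-- The second inclusion into a disjoint union. -/
def inr (P Q : FinPoset.{u}) : Q ⟶ coprod P Q :=
  homMk (Q := coprod P Q) Sum.inr (fun _ _ h => .inr h) (by
    rintro p _ (h | h)
    exact ⟨_, h, rfl⟩)

/-- The morphism out of a disjoint union given by a pair of morphisms. -/
def desc {P Q R : FinPoset.{u}} (f : P ⟶ R) (g : Q ⟶ R) : coprod P Q ⟶ R :=
  homMk (P := coprod P Q) (Sum.elim (fn f) (fn g))
    (by
      rintro _ _ (h | h)
      · exact fn_stable f h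
      · exact fn_stable g h)
    (by
      rintro (p | q) r h
      · obtain ⟨p', h', rfl⟩ := fn_open f h
        exact ⟨.inl p', .inl h', rfl⟩
      · obtain ⟨q', h', rfl⟩ := fn_open g h
        exact ⟨.inr q', .inr h', rfl⟩)

@[simp]
theorem inl_desc {P Q R : FinPoset.{u}} (f : P ⟶ R) (g : Q ⟶ R) : inl P Q ≫ desc f g = f := rfl

@[simp]
theorem inr_desc {P Q R : FinPoset.{u}} (f : P ⟶ R) (g : Q ⟶ R) : inr P Q ≫ desc f g = g := rfl

theorem coprod_hom_ext {P Q R : FinPoset.{u}} {f g : coprod P Q ⟶ R}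
    (h₁ : inl P Q ≫ f = inl P Q ≫ g) (h₂ : inr P Q ≫ f = inr P Q ≫ g) : f = g := by
  refine hom_ext ?_
  rintro (p | q)
  · exact congrFun (congrArg fn h₁) p
  · exact congrFun (congrArg fn h₂) q

/-! ### Upsets, images and principal upsets -/

/-- An upset, as a finite poset. -/
def sub {P : FinPoset.{u}} (U : GenSub P.obj) : FinPoset.{u} where
  obj := ⟨{p // p ∈ U.carrier}, fun p q => P.obj.rel p.1 q.1⟩
  property :=
    { finite := by
        have := P.finite
        exact inferInstanceAs (Finite {p // p ∈ U.carrier})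
      refl := fun p => P.refl p.1
      trans := fun _ _ _ => trans
      antisymm := fun _ _ h h' => Subtype.ext (antisymm h h') }

/-- The inclusion of an upset. -/
def incl {P : FinPoset.{u}} (U : GenSub P.obj) : sub U ⟶ P :=
  homMk (P := sub U) Subtype.val (fun _ _ h => h)
    fun p q h => ⟨⟨q, U.closed _ _ p.2 h⟩, h, rfl⟩

/-- A morphism with values in an upset, as a morphism to this upset. -/
def lift {P Q : FinPoset.{u}} (f : Q ⟶ P) (U : GenSub P.obj) (h : ∀ q, fn f q ∈ U.carrier) :
    Q ⟶ sub U :=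
  homMk (Q := sub U) (fun q => ⟨fn f q, h q⟩) (fun _ _ => fn_stable f) fun q r h => by
    obtain ⟨q', h', h''⟩ := fn_open f h
    exact ⟨q', h', Subtype.ext h''⟩

/-- The image of a morphism, as an upset. -/
def range {P Q : FinPoset.{u}} (f : P ⟶ Q) : GenSub Q.obj :=
  ⟨Set.range (fn f), by
    rintro _ q ⟨p, rfl⟩ h
    obtain ⟨p', -, rfl⟩ := fn_open f h
    exact ⟨p', rfl⟩⟩

theorem lift_range_surjective {P Q : FinPoset.{u}} (f : P ⟶ Q) :
    Function.Surjective (fn (lift f (range f) fun p => ⟨p, rfl⟩)) := by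
  rintro ⟨_, p, rfl⟩
  exact ⟨p, rfl⟩

/-- The root of a principal upset. -/
def root {P : FinPoset.{u}} (p : P.obj.carrier) : (sub (principal p)).obj.carrier := ⟨p, P.refl p⟩

/-- The restriction of a morphism to a principal upset. -/
def rootMap {P Q : FinPoset.{u}} (f : P ⟶ Q) (p : P.obj.carrier) :
    sub (principal p) ⟶ sub (principal (fn f p)) :=
  lift (incl _ ≫ f) _ fun q => fn_stable f q.2

theorem rootMap_incl {P Q : FinPoset.{u}} (f : P ⟶ Q) (p : P.obj.carrier) :
    rootMap f p ≫ incl _ = incl _ ≫ f := rfl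

theorem rootMap_surjective {P Q : FinPoset.{u}} (f : P ⟶ Q) (p : P.obj.carrier) :
    Function.Surjective (fn (rootMap f p)) := by
  rintro ⟨q, hq⟩
  obtain ⟨p', h, rfl⟩ := fn_open f hq
  exact ⟨⟨p', h⟩, rfl⟩

/-! ### Kernel pairs and quotients by surjections -/

/-- The kernel pair of a morphism. -/
def kernelPair {P Q : FinPoset.{u}} (f : P ⟶ Q) : FinPoset.{u} where
  obj := ⟨{x : P.obj.carrier × P.obj.carrier // fn f x.1 = fn f x.2},
    fun x y => P.obj.rel x.1.1 y.1.1 ∧ P.obj.rel x.1.2 y.1.2⟩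
  property :=
    { finite := by
        have := P.finite
        exact inferInstanceAs
          (Finite {x : P.obj.carrier × P.obj.carrier // fn f x.1 = fn f x.2})
      refl := fun x => ⟨P.refl _, P.refl _⟩
      trans := fun _ _ _ h h' => ⟨trans h.1 h'.1, trans h.2 h'.2⟩
      antisymm := fun _ _ h h' =>
        Subtype.ext (Prod.ext (antisymm h.1 h'.1) (antisymm h.2 h'.2)) }

/-- The first projection of a kernel pair. -/
def kernelFst {P Q : FinPoset.{u}} (f : P ⟶ Q) : kernelPair f ⟶ P :=
  homMk (P := kernelPair f) (fun x => x.1.1) (fun _ _ h => h.1) fun x p h => by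
    have h' := fn_stable f h
    rw [x.2] at h'
    obtain ⟨q, hq, hq'⟩ := fn_open f h'
    exact ⟨⟨(p, q), hq'.symm⟩, ⟨h, hq⟩, rfl⟩

/-- The second projection of a kernel pair. -/
def kernelSnd {P Q : FinPoset.{u}} (f : P ⟶ Q) : kernelPair f ⟶ P :=
  homMk (P := kernelPair f) (fun x => x.1.2) (fun _ _ h => h.2) fun x p h => by
    have h' := fn_stable f h
    rw [← x.2] at h'
    obtain ⟨q, hq, hq'⟩ := fn_open f h'
    exact ⟨⟨(q, p), hq'⟩, ⟨hq, h⟩, rfl⟩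

theorem kernel_condition {P Q : FinPoset.{u}} (f : P ⟶ Q) :
    kernelFst f ≫ f = kernelSnd f ≫ f := hom_ext fun x => x.2

/-- A map constant on the fibres of h descends as a function; monotonicity and openness descend
because order relations in Q lift along h. -/
theorem exists_factor {P Q R : FinPoset.{u}} {h : P ⟶ Q} (hh : Function.Surjective (fn h))
    {k : P ⟶ R} (hk : kernelFst h ≫ k = kernelSnd h ≫ k) : ∃ k' : Q ⟶ R, h ≫ k' = k := by
  have hk' {x y} (hxy : fn h x = fn h y) : fn k x = fn k y :=
    congrFun (congrArg fn hk) (⟨(x, y), hxy⟩ : (kernelPair h).obj.carrier)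
  have hs (x) : fn k (Function.surjInv hh (fn h x)) = fn k x :=
    hk' (Function.surjInv_eq hh _)
  refine ⟨homMk (fun q => fn k (Function.surjInv hh q)) ?_ ?_, hom_ext hs⟩
  · intro q q' hq
    obtain ⟨x, rfl⟩ := hh q
    obtain ⟨x', hx, rfl⟩ := fn_open h hq
    rw [hs, hs]
    exact fn_stable k hx
  · intro q r hq
    obtain ⟨x, rfl⟩ := hh q
    rw [hs] at hq
    obtain ⟨x', hx, rfl⟩ := fn_open k hq
    exact ⟨fn h x', fn_stable h hx, hs x'⟩

/-! ### Coequalizers -/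

/-- The equivalence relation generated by a pair of parallel morphisms. -/
def coeqSetoid {P Q : FinPoset.{u}} (f g : P ⟶ Q) : Setoid Q.obj.carrier :=
  Relation.EqvGen.setoid fun x y => ∃ p, fn f p = x ∧ fn g p = y

/-- The generated equivalence is a bisimulation: the generating pairs lift because f and g are
p-morphisms, and the closure operations preserve this. -/
theorem coeqSetoid_lift {P Q : FinPoset.{u}} {f g : P ⟶ Q} {x y : Q.obj.carrier}
    (h : coeqSetoid f g x y) :
    (∀ x', Q.obj.rel x x' → ∃ y', Q.obj.rel y y' ∧ coeqSetoid f g x' y') ∧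
    (∀ y', Q.obj.rel y y' → ∃ x', Q.obj.rel x x' ∧ coeqSetoid f g x' y') := by
  induction h with
  | rel x y h =>
    obtain ⟨p, rfl, rfl⟩ := h
    constructor
    · intro x' h
      obtain ⟨p', hp, rfl⟩ := fn_open f h
      exact ⟨_, fn_stable g hp, .rel _ _ ⟨p', rfl, rfl⟩⟩
    · intro x' h
      obtain ⟨p', hp, rfl⟩ := fn_open g h
      exact ⟨_, fn_stable f hp, .rel _ _ ⟨p', rfl, rfl⟩⟩
  | refl x => exact ⟨fun x' h => ⟨x', h, .refl _⟩, fun x' h => ⟨x', h, .refl _⟩⟩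
  | symm x y _ ih =>
    constructor
    · intro x' h
      obtain ⟨y', h, h'⟩ := ih.2 x' h
      exact ⟨y', h, .symm _ _ h'⟩
    · intro x' h
      obtain ⟨y', h, h'⟩ := ih.1 x' h
      exact ⟨y', h, .symm _ _ h'⟩
  | trans x y z _ _ ih ih' =>
    constructor
    · intro x' h
      obtain ⟨y', h, h1⟩ := ih.1 x' h
      obtain ⟨z', h, h2⟩ := ih'.1 y' h
      exact ⟨z', h, .trans _ _ _ h1 h2⟩
    · intro z' h
      obtain ⟨y', h, h1⟩ := ih'.2 z' h
      obtain ⟨x', h, h2⟩ := ih.2 y' h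
      exact ⟨x', h, .trans _ _ _ h2 h1⟩

/-- Finiteness makes the quotient antisymmetric. From a maximal m in the class of x, the
bisimulation climbs to some n in the class of y, then to some r back in the class of x. Maximality
gives r = m, so n = m and the classes agree. -/
theorem coeqSetoid_antisymm {P Q : FinPoset.{u}} {f g : P ⟶ Q} {x x' y y' : Q.obj.carrier}
    (h : Q.obj.rel x y) (h' : Q.obj.rel y' x') (hx : coeqSetoid f g x' x)
    (hy : coeqSetoid f g y y') : coeqSetoid f g x y := by
  obtain ⟨m, hm, hmax⟩ := exists_maximal (S := fun z => coeqSetoid f g x z)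
    ((coeqSetoid f g).refl x)
  obtain ⟨n, hmn, hn⟩ := (coeqSetoid_lift hm).1 y h
  obtain ⟨r, hnr, hr⟩ :=
    (coeqSetoid_lift ((coeqSetoid f g).trans ((coeqSetoid f g).symm hy) hn)).1 x' h'
  have hrm := hmax r (trans hmn hnr) ((coeqSetoid f g).trans ((coeqSetoid f g).symm hx) hr)
  subst hrm
  rw [antisymm hnr hmn] at hn
  exact (coeqSetoid f g).trans hm ((coeqSetoid f g).symm hn)

/-- The coequalizer of a pair of parallel morphisms. -/
def coeq {P Q : FinPoset.{u}} (f g : P ⟶ Q) : FinPoset.{u} where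
  obj := ⟨Quotient (coeqSetoid f g), fun a b => ∃ x y, ⟦x⟧ = a ∧ ⟦y⟧ = b ∧ Q.obj.rel x y⟩
  property :=
    { finite := by
        have := Q.finite
        exact inferInstanceAs (Finite (Quotient (coeqSetoid f g)))
      refl := by
        rintro ⟨x⟩
        exact ⟨x, x, rfl, rfl, Q.refl x⟩
      trans := by
        rintro _ _ _ ⟨x, y, rfl, rfl, h⟩ ⟨y', z, hy, rfl, h'⟩
        obtain ⟨z', h'', hz⟩ := (coeqSetoid_lift (Quotient.exact hy)).1 z h'
        exact ⟨x, z', rfl, (Quotient.sound hz).symm, trans h h''⟩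
      antisymm := by
        rintro _ _ ⟨x, y, rfl, rfl, h⟩ ⟨y', x', hy, hx, h'⟩
        exact Quotient.sound (coeqSetoid_antisymm h h' (Quotient.exact hx)
          (Quotient.exact hy.symm)) }

/-- The projection to a coequalizer. -/
def coeqProj {P Q : FinPoset.{u}} (f g : P ⟶ Q) : Q ⟶ coeq f g :=
  homMk (Q := coeq f g) (fun q => Quotient.mk (coeqSetoid f g) q)
    (fun x y h => ⟨x, y, rfl, rfl, h⟩) (by
      rintro x _ ⟨x', y, hx, rfl, h⟩
      obtain ⟨y', h', hy⟩ := (coeqSetoid_lift (Quotient.exact hx)).1 y h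
      exact ⟨y', h', (Quotient.sound hy).symm⟩)

theorem coeq_condition {P Q : FinPoset.{u}} (f g : P ⟶ Q) :
    f ≫ coeqProj f g = g ≫ coeqProj f g :=
  hom_ext fun p => Quotient.sound (.rel _ _ ⟨p, rfl, rfl⟩)

/-- The target is a bare set: the coequalizer of posets is also that of underlying sets, which is
what makes colourings flat. -/
theorem exists_coeq_desc {P Q : FinPoset.{u}} (f g : P ⟶ Q) {X : Type*} (k : Q.obj.carrier → X)
    (hk : ∀ p, k (fn f p) = k (fn g p)) :
    ∃ k' : (coeq f g).obj.carrier → X, k' ∘ fn (coeqProj f g) = k := by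
  refine ⟨Quotient.lift k fun x y h => ?_, rfl⟩
  induction h with
  | rel x y h =>
    obtain ⟨p, rfl, rfl⟩ := h
    exact hk p
  | refl => rfl
  | symm _ _ _ ih => exact ih.symm
  | trans _ _ _ _ _ ih ih' => exact ih.trans ih'

/-- The isomorphism of finite posets given by a bijection preserving and reflecting the order. -/
def isoMk {P Q : FinPoset.{u}} (e : P.obj.carrier ≃ Q.obj.carrier)
    (h : ∀ p p', P.obj.rel p p' ↔ Q.obj.rel (e p) (e p')) : P ≅ Q where
  hom := homMk e (fun p p' => (h p p').1) fun p q hq =>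
    ⟨e.symm q, by rw [h, e.apply_symm_apply]; exact hq, e.apply_symm_apply q⟩
  inv := homMk e.symm
    (fun q q' hq => by rw [h, e.apply_symm_apply, e.apply_symm_apply]; exact hq)
    fun q p hp => ⟨e p, by rw [h, e.apply_symm_apply] at hp; exact hp, e.symm_apply_apply p⟩
  hom_inv_id := hom_ext e.symm_apply_apply
  inv_hom_id := hom_ext e.apply_symm_apply

/-- A finite poset is coded by a relation on `Fin n`. Smallness provides the small weakly terminal
family required of an ind-object. -/
instance : EssentiallySmall.{u} FinPoset.{u} := by
  rw [essentiallySmall_iff]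
  refine ⟨?_, inferInstance⟩
  have hfin (P : FinPoset.{u}) : Nonempty (P.obj.carrier ≃ Fin (Nat.card P.obj.carrier)) := by
    have := P.finite
    exact ⟨Finite.equivFin _⟩
  let code (P : FinPoset.{u}) : Σ n : ℕ, Fin n → Fin n → Prop :=
    ⟨Nat.card P.obj.carrier, fun i j => P.obj.rel ((hfin P).some.symm i) ((hfin P).some.symm j)⟩
  have hcode {P Q : FinPoset.{u}} (h : code P = code Q) : Nonempty (P ≅ Q) := by
    have key : ∀ (x : Σ n : ℕ, Fin n → Fin n → Prop), x = code Q →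
        ∃ e : Fin x.1 ≃ Q.obj.carrier, ∀ i j, x.2 i j ↔ Q.obj.rel (e i) (e j) := by
      rintro _ rfl
      exact ⟨(hfin Q).some.symm, fun i j => Iff.rfl⟩
    obtain ⟨e, he⟩ := key (code P) h
    refine ⟨isoMk ((hfin P).some.trans e) fun p p' => ?_⟩
    refine Iff.trans ?_ (he _ _)
    change _ ↔ P.obj.rel _ _
    rw [Equiv.symm_apply_apply, Equiv.symm_apply_apply]
  refine small_of_injective (β := Σ n : ℕ, Fin n → Fin n → Prop)
    (f := fun X : Skeleton FinPoset.{u} => code ((fromSkeleton _).obj X)) fun X Y h => ?_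
  obtain ⟨e⟩ := hcode h
  exact skeleton_skeletal _ ⟨(fromSkeleton FinPoset.{u}).preimageIso e⟩

end FinPoset

/-! ### Ind-objects in finite posets -/

open FinPoset

/-- The action of a presheaf on finite posets on morphisms. -/
def res {A : FinPoset.{u}ᵒᵖ ⥤ Type u} {P Q : FinPoset.{u}} (f : P ⟶ Q) (a : A.obj (op Q)) :
    A.obj (op P) := A.map f.op a

section

variable {A B : FinPoset.{u}ᵒᵖ ⥤ Type u} {P Q R : FinPoset.{u}}

@[simp]
theorem res_id (a : A.obj (op P)) : res (𝟙 P) a = a := by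
  simp [res]

theorem res_comp (f : P ⟶ Q) (g : Q ⟶ R) (a : A.obj (op R)) :
    res (f ≫ g) a = res f (res g a) := by
  simp [res]

theorem app_res (α : A ⟶ B) (f : P ⟶ Q) (a : A.obj (op Q)) :
    α.app (op P) (res f a) = res f (α.app (op Q) a) :=
  NatTrans.naturality_apply α f.op a

/-- The image under a presheaf of a commutative square. -/
theorem res_comp_eq {P' : FinPoset.{u}} {f : P ⟶ Q} {g : Q ⟶ R} {f' : P ⟶ P'} {g' : P' ⟶ R}
    (h : f ≫ g = f' ≫ g') (a : A.obj (op R)) : res f (res g a) = res f' (res g' a) := by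
  rw [← res_comp, h, res_comp]

end

/-- A presheaf on finite posets is flat if its category of elements is filtered. -/
structure IsFlat (A : FinPoset.{u}ᵒᵖ ⥤ Type u) : Prop where
  nonempty : ∃ P, Nonempty (A.obj (op P))
  common : ∀ {P Q : FinPoset.{u}} (a : A.obj (op P)) (b : A.obj (op Q)),
    ∃ (R : FinPoset.{u}) (x : P ⟶ R) (y : Q ⟶ R) (t : A.obj (op R)), res x t = a ∧ res y t = b
  coequalize : ∀ {P Q : FinPoset.{u}} (f g : P ⟶ Q) (a : A.obj (op Q)), res f a = res g a →
    ∃ (R : FinPoset.{u}) (x : Q ⟶ R) (t : A.obj (op R)), f ≫ x = g ≫ x ∧ res x t = a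

theorem isFlat_of_isIndObject {A : FinPoset.{u}ᵒᵖ ⥤ Type u} (hA : IsIndObject A) : IsFlat A := by
  have := hA.isFiltered
  let el {P : FinPoset.{u}} (a : A.obj (op P)) : CostructuredArrow yoneda A :=
    CostructuredArrow.mk (yonedaEquiv.symm a)
  let val (X : CostructuredArrow yoneda A) : A.obj (op X.left) := yonedaEquiv X.hom
  have val_map {X Y : CostructuredArrow yoneda A} (f : X ⟶ Y) : res f.left (val Y) = val X := by
    have h1 := CostructuredArrow.w f
    simp only [val]
    rw [← h1]
    exact yonedaEquiv_naturality _ _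
  have val_el {P : FinPoset.{u}} (a : A.obj (op P)) : val (el a) = a :=
    yonedaEquiv.apply_symm_apply a
  constructor
  · obtain ⟨X⟩ := IsFiltered.nonempty (C := CostructuredArrow yoneda A)
    exact ⟨X.left, ⟨val X⟩⟩
  · intro P Q a b
    refine ⟨_, (IsFiltered.leftToMax (el a) (el b)).left,
      (IsFiltered.rightToMax (el a) (el b)).left,
      val (IsFiltered.max (el a) (el b)), ?_, ?_⟩
    · exact (val_map _).trans (val_el a)
    · exact (val_map _).trans (val_el b)
  · intro P Q f g a h
    let f' : el (res f a) ⟶ el a := CostructuredArrow.homMk f (by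
      apply yonedaEquiv.injective
      exact (yonedaEquiv_naturality _ _).symm.trans
        ((congrArg (res f) (val_el a)).trans (val_el (res f a)).symm))
    let g' : el (res f a) ⟶ el a := CostructuredArrow.homMk g (by
      apply yonedaEquiv.injective
      exact (yonedaEquiv_naturality _ _).symm.trans
        ((congrArg (res g) (val_el a)).trans (h.symm.trans (val_el (res f a)).symm)))
    refine ⟨_, (IsFiltered.coeqHom f' g').left, val (IsFiltered.coeq f' g'), ?_, ?_⟩
    · exact congrArg CommaMorphism.left (IsFiltered.coeq_condition f' g')
    · exact (val_map _).trans (val_el a)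

theorem IsFlat.isIndObject {A : FinPoset.{u}ᵒᵖ ⥤ Type u} (hA : IsFlat A) : IsIndObject A := by
  rw [isIndObject_iff]
  let val (X : CostructuredArrow yoneda A) : A.obj (op X.left) := yonedaEquiv X.hom
  have val_map {X Y : CostructuredArrow yoneda A} (f : X ⟶ Y) : res f.left (val Y) = val X := by
    have h1 := CostructuredArrow.w f
    simp only [val]
    rw [← h1]
    exact yonedaEquiv_naturality _ _
  let hom {X : CostructuredArrow yoneda A} {Q : FinPoset.{u}} (f : X.left ⟶ Q) (b : A.obj (op Q))
      (h : res f b = val X) : X ⟶ CostructuredArrow.mk (yonedaEquiv.symm b) :=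
    CostructuredArrow.homMk f (by
      apply yonedaEquiv.injective
      exact (yonedaEquiv_naturality _ _).symm.trans
        ((congrArg (res f) (yonedaEquiv.apply_symm_apply b)).trans h))
  have : IsFilteredOrEmpty (CostructuredArrow yoneda A) :=
    { cocone_objs := fun X Y => by
        obtain ⟨R, x, y, t, hx, hy⟩ := hA.common (val X) (val Y)
        exact ⟨_, hom x t hx, hom y t hy, trivial⟩
      cocone_maps := fun X Y f g => by
        obtain ⟨R, x, t, hx, ht⟩ := hA.coequalize f.left g.left (val Y)
          ((val_map f).trans (val_map g).symm)
        exact ⟨_, hom x t ht, CostructuredArrow.hom_ext _ _ hx⟩ }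
  obtain ⟨P, ⟨a⟩⟩ := hA.nonempty
  refine ⟨{ nonempty := ⟨CostructuredArrow.mk (yonedaEquiv.symm a)⟩ }, ?_⟩
  let e := equivSmallModel.{u} FinPoset.{u}
  refine finallySmall_of_small_weakly_terminal_set
    (Set.range fun x : Σ m : SmallModel.{u} FinPoset.{u}, A.obj (op (e.inverse.obj m)) =>
      (CostructuredArrow.mk (yonedaEquiv.symm x.2) : CostructuredArrow yoneda A)) fun X => ?_
  refine ⟨_, ⟨⟨e.functor.obj X.left, res (e.unitIso.inv.app X.left) (val X)⟩, rfl⟩,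
    ⟨hom (e.unitIso.hom.app X.left) _ ?_⟩⟩
  rw [← res_comp, Iso.hom_inv_id_app]
  exact res_id _

/-! ### Flat presheaves and finite colimits of posets -/

namespace IsFlat

variable {A B : FinPoset.{u}ᵒᵖ ⥤ Type u}

/-- Surjections are epimorphisms: after a and b are made restrictions of one element, coequalizing
along h already coequalizes. -/
theorem res_injective (hA : IsFlat A) {P Q : FinPoset.{u}} {h : P ⟶ Q}
    (hh : Function.Surjective (fn h)) {a b : A.obj (op Q)} (hab : res h a = res h b) : a = b := by
  obtain ⟨R, x, y, t, rfl, rfl⟩ := hA.common a b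
  rw [← res_comp, ← res_comp] at hab
  obtain ⟨S, z, t, hz, rfl⟩ := hA.coequalize _ _ _ hab
  have : x ≫ z = y ≫ z := hom_ext fun q => by
    obtain ⟨p, rfl⟩ := hh q
    exact congrFun (congrArg fn hz) p
  exact res_comp_eq this t

theorem coprod_ext (hA : IsFlat A) {P Q : FinPoset.{u}} {a b : A.obj (op (coprod P Q))}
    (h₁ : res (inl P Q) a = res (inl P Q) b) (h₂ : res (inr P Q) a = res (inr P Q) b) : a = b := by
  obtain ⟨R, x, y, t, rfl, rfl⟩ := hA.common a b
  rw [← res_comp, ← res_comp] at h₁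
  obtain ⟨S, z, t, hz, rfl⟩ := hA.coequalize _ _ _ h₁
  simp only [← res_comp] at h₂ ⊢
  obtain ⟨S', z', t, hz', rfl⟩ := hA.coequalize _ _ _ h₂
  simp only [← res_comp]
  congr 1
  exact coprod_hom_ext (by simpa using congrArg (· ≫ z') hz) (by simpa using hz')

theorem exists_coprod (hA : IsFlat A) {P Q : FinPoset.{u}} (a : A.obj (op P)) (b : A.obj (op Q)) :
    ∃ c : A.obj (op (coprod P Q)), res (inl P Q) c = a ∧ res (inr P Q) c = b := by
  obtain ⟨R, x, y, t, rfl, rfl⟩ := hA.common a b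
  exact ⟨res (desc x y) t, by rw [← res_comp, inl_desc], by rw [← res_comp, inr_desc]⟩

/-- Coequalizing the kernel pair of h makes the representing morphism factor through h, by
`exists_factor`. -/
theorem exists_descent (hA : IsFlat A) {P Q : FinPoset.{u}} {h : P ⟶ Q}
    (hh : Function.Surjective (fn h)) {a : A.obj (op P)}
    (ha : res (kernelFst h) a = res (kernelSnd h) a) : ∃ b, res h b = a := by
  obtain ⟨R, x, t, hx, rfl⟩ := hA.coequalize _ _ _ ha
  obtain ⟨k, rfl⟩ := exists_factor hh hx
  exact ⟨res k t, (res_comp _ _ _).symm⟩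

theorem empty_ext (hA : IsFlat A) {P : FinPoset.{u}} [IsEmpty P.obj.carrier] (a b : A.obj (op P)) :
    a = b := by
  obtain ⟨R, x, y, t, rfl, rfl⟩ := hA.common a b
  rw [show x = y from hom_ext fun p => isEmptyElim p]

end IsFlat

/-! ### Colourings and equalizers as flat presheaves -/

/-- The presheaf of colourings of finite posets in `X`. -/
def colorings (X : Type u) : FinPoset.{u}ᵒᵖ ⥤ Type u where
  obj P := P.unop.obj.carrier → X
  map f := TypeCat.ofHom fun k => k ∘ fn f.unop

theorem isFlat_colorings (X : Type u) : IsFlat (colorings X) where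
  nonempty := ⟨⟨⟨PEmpty, fun _ _ => True⟩, ⟨inferInstanceAs (Finite PEmpty), fun _ => trivial,
    fun _ _ _ _ _ => trivial, fun p => p.elim⟩⟩, ⟨(PEmpty.elim : PEmpty → X)⟩⟩
  common {P Q} a b := ⟨coprod P Q, inl P Q, inr P Q, (Sum.elim a b : _ ⊕ _ → X), rfl, rfl⟩
  coequalize f g a h := by
    obtain ⟨k, hk⟩ := exists_coeq_desc f g a (congrFun h)
    exact ⟨coeq f g, coeqProj f g, k, coeq_condition f g, hk⟩

/-- The equalizer of a pair of morphisms of presheaves. -/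
def equalizerPresheaf {A B : FinPoset.{u}ᵒᵖ ⥤ Type u} (f g : A ⟶ B) : FinPoset.{u}ᵒᵖ ⥤ Type u where
  obj P := {a : A.obj P // f.app P a = g.app P a}
  map {P Q} k := TypeCat.ofHom fun a => ⟨A.map k a.1, by
    rw [NatTrans.naturality_apply, NatTrans.naturality_apply, a.2]⟩

/-- The inclusion of an equalizer. -/
def equalizerIncl {A B : FinPoset.{u}ᵒᵖ ⥤ Type u} (f g : A ⟶ B) : equalizerPresheaf f g ⟶ A where
  app P := TypeCat.ofHom Subtype.val

theorem equalizerIncl_condition {A B : FinPoset.{u}ᵒᵖ ⥤ Type u} (f g : A ⟶ B) :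
    equalizerIncl f g ≫ f = equalizerIncl f g ≫ g := by
  ext P a
  exact a.2

theorem IsFlat.equalizer {A B : FinPoset.{u}ᵒᵖ ⥤ Type u} (hA : IsFlat A) (hB : IsFlat B)
    (f g : A ⟶ B) : IsFlat (equalizerPresheaf f g) where
  nonempty := by
    obtain ⟨P, ⟨a⟩⟩ := hA.nonempty
    let U : GenSub P.obj := ⊥
    have : IsEmpty (sub U).obj.carrier := ⟨fun p => p.2⟩
    exact ⟨sub U, ⟨⟨res (incl U) a, hB.empty_ext _ _⟩⟩⟩
  common {P Q} a b := by
    obtain ⟨c, hc, hc'⟩ := hA.exists_coprod a.1 b.1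
    refine ⟨coprod P Q, inl P Q, inr P Q, ⟨c, hB.coprod_ext ?_ ?_⟩, Subtype.ext hc,
      Subtype.ext hc'⟩
    · rw [← app_res, ← app_res, hc, a.2]
    · rw [← app_res, ← app_res, hc', b.2]
  coequalize {P Q} x y a h := by
    obtain ⟨R, k, t, hk, ht⟩ := hA.coequalize x y a.1 (congrArg Subtype.val h)
    -- The element t itself need not be equalized. On the image of k it is, since restriction along
    -- the surjection k' is injective on B.
    let k' := FinPoset.lift k (range k) fun p => ⟨p, rfl⟩
    have hk' : res k' (res (incl (range k)) t) = a.1 := by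
      rw [← ht, ← res_comp]
      rfl
    refine ⟨sub (range k), k', ⟨res (incl _) t, ?_⟩, ?_, Subtype.ext hk'⟩
    · apply hB.res_injective (lift_range_surjective k)
      rw [← app_res, ← app_res]
      exact (congrArg _ hk').trans (a.2.trans (congrArg _ hk').symm)
    · exact hom_ext fun p => Subtype.ext (congrFun (congrArg fn hk) p)

/-! ### Morphisms to the powerset presheaf -/

/-- The presheaf of powersets of finite posets. -/
def powPresheaf : FinPoset.{u}ᵒᵖ ⥤ Type u := FinPoset.powerset ⋙ FinGrz.forget

/-- The predicate on the points of the elements of `A` given by a morphism to the powerset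
presheaf. -/
def Holds {A : FinPoset.{u}ᵒᵖ ⥤ Type u} (φ : A ⟶ powPresheaf) {P : FinPoset.{u}}
    (a : A.obj (op P)) (p : P.obj.carrier) : Prop :=
  Membership.mem (γ := Pow P.obj) (φ.app (op P) a) p

section Holds

variable {A B : FinPoset.{u}ᵒᵖ ⥤ Type u}

theorem holds_res (φ : A ⟶ powPresheaf) {P Q : FinPoset.{u}} (f : P ⟶ Q) (a : A.obj (op Q))
    (p : P.obj.carrier) : Holds φ (res f a) p ↔ Holds φ a (fn f p) := by
  unfold Holds
  rw [app_res]
  rfl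

theorem holds_comp (α : A ⟶ B) (φ : B ⟶ powPresheaf) {P : FinPoset.{u}} (a : A.obj (op P))
    (p : P.obj.carrier) : Holds (α ≫ φ) a p ↔ Holds φ (α.app (op P) a) p := Iff.rfl

theorem holds_ext {φ ψ : A ⟶ powPresheaf}
    (h : ∀ (P : FinPoset.{u}) (a : A.obj (op P)) p, Holds φ a p ↔ Holds ψ a p) : φ = ψ := by
  ext P a
  exact Pow.ext (P := P.unop.obj) (h P.unop a)

/-- The morphism to the powerset presheaf given by a predicate on points. -/
def ofPred (N : ∀ {P : FinPoset.{u}}, A.obj (op P) → P.obj.carrier → Prop)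
    (hN : ∀ {P Q : FinPoset.{u}} (f : P ⟶ Q) (a : A.obj (op Q)) p,
      N (res f a) p ↔ N a (fn f p)) : A ⟶ powPresheaf where
  app P := TypeCat.ofHom fun a => ({p | N (P := P.unop) a p} : Set P.unop.obj.carrier)
  naturality P Q f := by
    ext a
    exact Pow.ext (P := Q.unop.obj) fun p => hN f.unop a p

end Holds

/-! ### Points and germs; detecting isomorphisms -/

section

variable {A B : FinPoset.{u}ᵒᵖ ⥤ Type u}

/-- Two points of elements of a presheaf coincide if they do so in a common extension. -/
def SamePoint {P Q : FinPoset.{u}} (a : A.obj (op P)) (p : P.obj.carrier) (b : A.obj (op Q))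
    (q : Q.obj.carrier) : Prop :=
  ∃ (R : FinPoset.{u}) (x : P ⟶ R) (y : Q ⟶ R) (t : A.obj (op R)),
    res x t = a ∧ res y t = b ∧ fn x p = fn y q

namespace SamePoint

variable {P Q R : FinPoset.{u}} {a : A.obj (op P)} {p : P.obj.carrier} {b : A.obj (op Q)}
  {q : Q.obj.carrier} {c : A.obj (op R)} {r : R.obj.carrier}

theorem refl (a : A.obj (op P)) (p : P.obj.carrier) : SamePoint a p a p :=
  ⟨P, 𝟙 P, 𝟙 P, a, res_id a, res_id a, rfl⟩

theorem symm (h : SamePoint a p b q) : SamePoint b q a p := by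
  obtain ⟨R, x, y, t, hx, hy, h⟩ := h
  exact ⟨R, y, x, t, hy, hx, h.symm⟩

theorem trans (hA : IsFlat A) (h : SamePoint a p b q) (h' : SamePoint b q c r) :
    SamePoint a p c r := by
  obtain ⟨S, x, y, t, rfl, rfl, h⟩ := h
  obtain ⟨S', x', y', t', hb, rfl, h'⟩ := h'
  obtain ⟨T, u, v, t, rfl, rfl⟩ := hA.common t t'
  rw [← res_comp, ← res_comp] at hb
  obtain ⟨T', w, t, hw, rfl⟩ := hA.coequalize _ _ _ hb
  refine ⟨T', x ≫ u ≫ w, y' ≫ v ≫ w, t, by simp only [res_comp], by simp only [res_comp], ?_⟩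
  have := congrFun (congrArg fn hw) q
  simp only [fn_comp, Function.comp_apply] at this ⊢
  rw [h, ← this, h']

theorem of_res (f : P ⟶ Q) (b : A.obj (op Q)) (p : P.obj.carrier) :
    SamePoint (res f b) p b (fn f p) :=
  ⟨Q, f, 𝟙 Q, b, rfl, res_id b, rfl⟩

end SamePoint

/-- The coincidences at the finitely many points of P are realized successively in one common
extension, where the two morphisms from P become equal. -/
theorem IsFlat.eq_of_samePoint (hA : IsFlat A) {P : FinPoset.{u}} {a b : A.obj (op P)}
    (h : ∀ p, SamePoint a p b p) : a = b := by
  classical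
  have := P.finite
  have := Fintype.ofFinite P.obj.carrier
  have key : ∀ S : Finset P.obj.carrier, ∃ (R : FinPoset.{u}) (x y : P ⟶ R) (t : A.obj (op R)),
      res x t = a ∧ res y t = b ∧ ∀ p ∈ S, fn x p = fn y p := by
    intro S
    induction S using Finset.induction_on with
    | empty =>
      obtain ⟨R, x, y, t, hx, hy⟩ := hA.common a b
      exact ⟨R, x, y, t, hx, hy, by simp⟩
    | insert p S _ ih =>
      obtain ⟨R, x, y, t, rfl, rfl, hS⟩ := ih
      obtain ⟨R', x', y', t', hx, hy, hp⟩ := h p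
      obtain ⟨T, u, v, t, rfl, rfl⟩ := hA.common t t'
      rw [← res_comp, ← res_comp] at hx
      obtain ⟨T', w, t, hw, rfl⟩ := hA.coequalize _ _ _ hx
      rw [← res_comp, ← res_comp, ← res_comp, ← res_comp] at hy
      obtain ⟨T'', w', t, hw', rfl⟩ := hA.coequalize _ _ _ hy
      refine ⟨T'', x ≫ u ≫ w ≫ w', y ≫ u ≫ w ≫ w', t, by simp only [res_comp],
        by simp only [res_comp], ?_⟩
      intro q hq
      simp only [fn_comp, Function.comp_apply]
      rcases Finset.mem_insert.1 hq with rfl | hq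
      · have h1 := congrFun (congrArg fn hw) q
        have h2 := congrFun (congrArg fn hw') q
        simp only [fn_comp, Function.comp_apply] at h1 h2
        rw [← h1, ← h2, hp]
      · rw [hS q hq]
  obtain ⟨R, x, y, t, rfl, rfl, hS⟩ := key Finset.univ
  rw [hom_ext fun p => hS p (Finset.mem_univ p)]

/-- The morphism to the powerset presheaf classifying a point. -/
def pointPred (hA : IsFlat A) {P : FinPoset.{u}} (a : A.obj (op P)) (p : P.obj.carrier) :
    A ⟶ powPresheaf :=
  ofPred (fun b q => SamePoint b q a p) fun f b q =>
    ⟨fun h => (SamePoint.of_res f b q).symm.trans hA h,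
      fun h => (SamePoint.of_res f b q).trans hA h⟩

/-- If a and b have the same image, a predicate on B pulling back to "equals the point p of b"
cannot separate a from b at p. -/
theorem app_injective (hA : IsFlat A) (α : A ⟶ B)
    (hα : Function.Surjective fun φ : B ⟶ powPresheaf => α ≫ φ) {P : FinPoset.{u}} :
    Function.Injective (α.app (op P)) := by
  intro a b h
  refine hA.eq_of_samePoint fun p => ?_
  obtain ⟨φ, hφ⟩ := hα (pointPred hA b p)
  have h1 : Holds (α ≫ φ) b p := by
    rw [show α ≫ φ = _ from hφ]
    exact SamePoint.refl b p
  rw [holds_comp, ← h, ← holds_comp, show α ≫ φ = _ from hφ] at h1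
  exact h1

/-- The restriction of an element to the principal upset of a point. -/
def germ {P : FinPoset.{u}} (a : A.obj (op P)) (p : P.obj.carrier) :
    A.obj (op (sub (principal p))) := res (incl _) a

theorem germ_res {P Q : FinPoset.{u}} (f : P ⟶ Q) (a : A.obj (op Q)) (p : P.obj.carrier) :
    germ (res f a) p = res (rootMap f p) (germ a (fn f p)) :=
  res_comp_eq (rootMap_incl f p).symm a

theorem app_germ (α : A ⟶ B) {P : FinPoset.{u}} (a : A.obj (op P)) (p : P.obj.carrier) :
    α.app _ (germ a p) = germ (α.app _ a) p := app_res _ _ _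

theorem holds_germ (φ : A ⟶ powPresheaf) {P : FinPoset.{u}} (a : A.obj (op P))
    (p : P.obj.carrier) : Holds φ (germ a p) (root p) ↔ Holds φ a p := holds_res _ _ _ _

/-- A preimage of `res h b` satisfies the descent condition because α is injective, so it descends
along h. -/
theorem mem_range_of_res (hA : IsFlat A) (hB : IsFlat B) {α : A ⟶ B}
    (hα : ∀ P : FinPoset.{u}, Function.Injective (α.app (op P))) {P Q : FinPoset.{u}} {h : P ⟶ Q}
    (hh : Function.Surjective (fn h)) {b : B.obj (op Q)}
    (hb : res h b ∈ Set.range (α.app (op P))) : b ∈ Set.range (α.app (op Q)) := by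
  obtain ⟨a, ha⟩ := hb
  obtain ⟨a, rfl⟩ := hA.exists_descent hh (a := a) (by
    apply hα
    rw [app_res, app_res, ha]
    exact res_comp_eq (kernel_condition h) b)
  rw [app_res] at ha
  exact ⟨a, hB.res_injective hh ha⟩

theorem mem_range_of_sup (hA : IsFlat A) (hB : IsFlat B) {α : A ⟶ B}
    (hα : ∀ P : FinPoset.{u}, Function.Injective (α.app (op P))) {P : FinPoset.{u}}
    {b : B.obj (op P)} {U V : GenSub P.obj}
    (hU : res (incl U) b ∈ Set.range (α.app _)) (hV : res (incl V) b ∈ Set.range (α.app _)) :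
    res (incl (U ⊔ V)) b ∈ Set.range (α.app _) := by
  obtain ⟨a, ha⟩ := hU
  obtain ⟨a', ha'⟩ := hV
  obtain ⟨c, rfl, rfl⟩ := hA.exists_coprod a a'
  let h : coprod (sub U) (sub V) ⟶ sub (U ⊔ V) :=
    desc (FinPoset.lift (incl U) _ fun p => Or.inl p.2)
      (FinPoset.lift (incl V) _ fun p => Or.inr p.2)
  have hh : Function.Surjective (fn h) := by
    rintro ⟨p, hp | hp⟩
    · exact ⟨Sum.inl ⟨p, hp⟩, rfl⟩
    · exact ⟨Sum.inr ⟨p, hp⟩, rfl⟩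
  refine mem_range_of_res hA hB hα hh ⟨c, hB.coprod_ext ?_ ?_⟩
  · rw [← app_res, ha, ← res_comp, ← res_comp]
    rfl
  · rw [← app_res, ha', ← res_comp, ← res_comp]
    rfl

/-- The morphism to the powerset presheaf classifying the image of a monomorphism. -/
def rangePred (hA : IsFlat A) (hB : IsFlat B) (α : A ⟶ B)
    (hα : ∀ P : FinPoset.{u}, Function.Injective (α.app (op P))) : B ⟶ powPresheaf :=
  ofPred (fun b p => germ b p ∈ Set.range (α.app _)) fun f b p => by
    rw [germ_res]
    refine ⟨mem_range_of_res hA hB hα (rootMap_surjective f p), ?_⟩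
    rintro ⟨a, ha⟩
    exact ⟨res (rootMap f p) a, by rw [app_res, ha]⟩

/-- The image predicate and the true predicate agree on A, hence on B. Thus all germs of b lie in
the image, and finitely many of them glue to b. -/
theorem app_surjective (hA : IsFlat A) (hB : IsFlat B) (α : A ⟶ B)
    (hα : ∀ P : FinPoset.{u}, Function.Injective (α.app (op P)))
    (hα' : Function.Injective fun φ : B ⟶ powPresheaf => α ≫ φ) {P : FinPoset.{u}} :
    Function.Surjective (α.app (op P)) := by
  classical
  intro b
  have h1 : rangePred hA hB α hα = ofPred (fun _ _ => True) fun _ _ _ => Iff.rfl := by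
    refine hα' (holds_ext fun Q a q => ?_)
    rw [holds_comp, holds_comp]
    exact ⟨fun _ => trivial, fun _ => ⟨germ a q, app_germ α a q⟩⟩
  have h2 (p : P.obj.carrier) : germ b p ∈ Set.range (α.app _) := by
    change Holds (rangePred hA hB α hα) b p
    rw [h1]
    trivial
  have := P.finite
  have := Fintype.ofFinite P.obj.carrier
  have key : ∀ S : Finset P.obj.carrier,
      res (incl (S.sup principal)) b ∈ Set.range (α.app _) := by
    intro S
    induction S using Finset.induction_on with
    | empty =>
      obtain ⟨Q, ⟨a⟩⟩ := hA.nonempty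
      have : IsEmpty (sub (⊥ : GenSub P.obj)).obj.carrier := ⟨fun p => p.2⟩
      rw [Finset.sup_empty]
      let f : sub (⊥ : GenSub P.obj) ⟶ Q :=
        homMk isEmptyElim (fun p => isEmptyElim p) (fun p => isEmptyElim p)
      exact ⟨res f a, hB.empty_ext _ _⟩
    | insert p S _ ih =>
      rw [Finset.sup_insert]
      exact mem_range_of_sup hA hB hα (h2 p) ih
  refine mem_range_of_res hA hB hα (h := incl _) ?_ (key Finset.univ)
  intro p
  exact ⟨⟨p, GenSub.le_iff.1 (Finset.le_sup (f := principal) (Finset.mem_univ p)) p (P.refl p)⟩,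
    rfl⟩

/-- A morphism of ind-objects inducing a bijection between the sets of morphisms to the powerset
presheaf is an isomorphism. -/
theorem isIso_of_bijective (hA : IsFlat A) (hB : IsFlat B) (α : A ⟶ B)
    (hα : Function.Bijective fun φ : B ⟶ powPresheaf => α ≫ φ) : IsIso α := by
  rw [NatTrans.isIso_iff_isIso_app]
  intro P
  rw [isIso_iff_bijective]
  have h1 (P : FinPoset.{u}) : Function.Injective (α.app (op P)) := app_injective hA α hα.2
  exact ⟨h1 P.unop, app_surjective hA hB α h1 hα.1⟩

/-! ### Coreflexive equalizers -/

/-- The extension by zero of a morphism to the powerset presheaf from an equalizer. -/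
def extendZero (hB : IsFlat B) {f g : A ⟶ B} (φ : equalizerPresheaf f g ⟶ powPresheaf) :
    A ⟶ powPresheaf :=
  ofPred (fun a p => ∃ h : f.app _ (germ a p) = g.app _ (germ a p),
      Holds φ (A := equalizerPresheaf f g) ⟨germ a p, h⟩ (root p)) fun {P Q} k a p => by
    have h0 : f.app _ (germ (res k a) p) = g.app _ (germ (res k a) p) ↔
        f.app _ (germ a (fn k p)) = g.app _ (germ a (fn k p)) := by
      rw [germ_res, app_res, app_res]
      exact ⟨hB.res_injective (rootMap_surjective k p), congrArg _⟩
    have h1 (h h') : Holds φ (A := equalizerPresheaf f g) ⟨germ (res k a) p, h⟩ (root p) ↔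
        Holds φ (A := equalizerPresheaf f g) ⟨germ a (fn k p), h'⟩ (root (fn k p)) := by
      have := holds_res φ (rootMap k p) (⟨germ a (fn k p), h'⟩ :
        (equalizerPresheaf f g).obj (op (sub (principal (fn k p))))) (root p)
      refine Iff.trans (iff_of_eq ?_) this
      congr 1
      exact Subtype.ext (germ_res k a p)
    exact ⟨fun ⟨h, h'⟩ => ⟨h0.1 h, (h1 h (h0.1 h)).1 h'⟩,
      fun ⟨h, h'⟩ => ⟨h0.2 h, (h1 (h0.2 h) h).2 h'⟩⟩

/-- The image of a morphism to the powerset presheaf along a split monomorphism. -/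
def directImage (hB : IsFlat B) (f : A ⟶ B) (r : B ⟶ A) (ψ : A ⟶ powPresheaf) :
    B ⟶ powPresheaf :=
  ofPred (fun b p => f.app _ (r.app _ (germ b p)) = germ b p ∧ Holds ψ (r.app _ b) p)
    fun {P Q} k b p => by
      refine and_congr ?_ ?_
      · rw [germ_res, app_res, app_res]
        exact ⟨hB.res_injective (rootMap_surjective k p), congrArg _⟩
      · rw [app_res, holds_res]

theorem equalizerIncl_extendZero (hB : IsFlat B) {f g : A ⟶ B}
    (φ : equalizerPresheaf f g ⟶ powPresheaf) :
    equalizerIncl f g ≫ extendZero hB φ = φ :=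
  holds_ext fun P a p => by
    rw [holds_comp, ← holds_germ φ a p]
    exact ⟨fun h => h.2, fun h => ⟨(germ a p).2, h⟩⟩

/-- Pulling the direct image back along the split monomorphism itself recovers ψ. -/
theorem comp_directImage (hB : IsFlat B) {f : A ⟶ B} {r : B ⟶ A} (hf : f ≫ r = 𝟙 A)
    (ψ : A ⟶ powPresheaf) : f ≫ directImage hB f r ψ = ψ :=
  holds_ext fun P a p => by
    have h (P : FinPoset.{u}) (a : A.obj (op P)) : r.app _ (f.app _ a) = a :=
      ConcreteCategory.congr_hom (congrArg (fun k => NatTrans.app k (op P)) hf) a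
    rw [holds_comp]
    refine (and_congr (iff_of_eq ?_) (iff_of_eq ?_)).trans (iff_of_eq (true_and _))
    · rw [← app_germ, h, eq_self]
    · rw [h]

/-- Beck–Chevalley: since r retracts g, a germ g(a) is fixed by f ∘ r exactly when f(a) = g(a), so
only the equalizer contributes. -/
theorem comp_directImage' (hB : IsFlat B) {f g : A ⟶ B} {r : B ⟶ A} (hg : g ≫ r = 𝟙 A)
    (ψ : A ⟶ powPresheaf) :
    g ≫ directImage hB f r ψ = extendZero hB (equalizerIncl f g ≫ ψ) :=
  holds_ext fun P a p => by
    have h (P : FinPoset.{u}) (a : A.obj (op P)) : r.app _ (g.app _ a) = a :=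
      ConcreteCategory.congr_hom (congrArg (fun k => NatTrans.app k (op P)) hg) a
    rw [holds_comp]
    have h1 : f.app _ (r.app _ (germ (g.app _ a) p)) = germ (g.app _ a) p ↔
        f.app _ (germ a p) = g.app _ (germ a p) := by
      rw [← app_germ, h]
    have h2 : Holds ψ (r.app _ (g.app _ a)) p ↔ Holds ψ (germ a p) (root p) := by
      rw [h, holds_germ]
    refine (and_congr h1 h2).trans ?_
    exact ⟨fun h => ⟨h.1, h.2⟩, fun ⟨h, h'⟩ => ⟨h, h'⟩⟩

end

/-! ### Monadicity -/

/-- The category of ind-objects in finite posets, as a category of presheaves. -/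
abbrev IndPoset := ObjectProperty.FullSubcategory (IsIndObject (C := FinPoset.{u}))

instance (A : IndPoset.{u}) : Small.{u} (A.obj ⟶ powPresheaf) :=
  small_hom_of_isIndObject A.property powPresheaf

instance : FunctorToTypes.Small.{u}
    ((ObjectProperty.ι (IsIndObject (C := FinPoset.{u}))).op ⋙ yoneda.obj powPresheaf) := fun A =>
  small_hom_of_isIndObject A.unop.property powPresheaf

/-- The contravariant functor sending an ind-object `A` to the set of morphisms from `A` to the
powerset presheaf. -/
noncomputable def IndPoset.pow : IndPoset.{u}ᵒᵖ ⥤ Type u :=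
  FunctorToTypes.shrink.{u}
    ((ObjectProperty.ι (IsIndObject (C := FinPoset.{u}))).op ⋙ yoneda.obj powPresheaf)

namespace IndPoset

theorem isFlat (A : IndPoset.{u}) : IsFlat A.obj := isFlat_of_isIndObject A.property

/-- The elements of the value of `IndPoset.pow`, as morphisms of presheaves. -/
noncomputable def powEquiv (A : IndPoset.{u}) :
    pow.obj (op A) ≃ (A.obj ⟶ powPresheaf) :=
  (equivShrink (A.obj ⟶ powPresheaf)).symm

theorem powEquiv_map {A B : IndPoset.{u}} (f : A ⟶ B) (φ : pow.obj (op B)) :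
    powEquiv A (pow.map f.op φ) = f.hom ≫ powEquiv B φ :=
  (equivShrink _).symm_apply_apply _

theorem map_powEquiv_symm {A B : IndPoset.{u}} (f : A ⟶ B) (φ : B.obj ⟶ powPresheaf) :
    pow.map f.op ((powEquiv B).symm φ) = (powEquiv A).symm (f.hom ≫ φ) := by
  apply (powEquiv A).injective
  rw [powEquiv_map, Equiv.apply_symm_apply, Equiv.apply_symm_apply]

/-- Colourings in a powerset are families of morphisms to the powerset presheaf. -/
def coloringsEquiv (A : FinPoset.{u}ᵒᵖ ⥤ Type u) (X : Type u) :
    (A ⟶ colorings (Set X)) ≃ (X → (A ⟶ powPresheaf)) where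
  toFun k x := ofPred (fun {P} a p => x ∈ (k.app (op P) a : P.obj.carrier → Set X) p)
    fun f a p => by
    rw [app_res]
    rfl
  invFun φ :=
    { app := fun P => TypeCat.ofHom fun a => fun p => ({x | Holds (P := P.unop) (φ x) a p} : Set X)
      naturality := fun P Q f => by
        ext a
        funext p
        ext x
        exact holds_res (φ x) f.unop a p }
  left_inv k := rfl
  right_inv φ := rfl

/-- The colourings by `Set X` form the X-fold power of `powPresheaf`, dual to the free profinite
algebra on X. -/
instance : pow.{u}.IsRightAdjoint :=
  (Adjunction.adjunctionOfEquivLeft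
    (F_obj := fun X => op ⟨colorings (Set X), (isFlat_colorings _).isIndObject⟩)
    (fun X A =>
      { toFun := fun k => TypeCat.ofHom fun x =>
          (powEquiv A.unop).symm (coloringsEquiv A.unop.obj X k.unop.hom x)
        invFun := fun h => Quiver.Hom.op (ObjectProperty.homMk
          ((coloringsEquiv A.unop.obj X).symm fun x => powEquiv A.unop (h x)))
        left_inv := fun k => by
          apply Quiver.Hom.unop_inj
          apply ObjectProperty.hom_ext
          refine (coloringsEquiv A.unop.obj X).symm_apply_eq.2 ?_
          funext x
          exact Equiv.apply_symm_apply _ _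
        right_inv := fun h => by
          ext x
          refine (powEquiv A.unop).symm_apply_eq.2 ?_
          exact congrFun ((coloringsEquiv A.unop.obj X).apply_symm_apply _) x })
    (fun X A B g h => by
      ext x
      change _ = pow.map g.unop.op ((powEquiv A.unop).symm _)
      rw [map_powEquiv_symm]
      rfl)).isRightAdjoint

instance : pow.{u}.ReflectsIsomorphisms where
  reflects {A B} f hf := by
    have hf := (isIso_iff_bijective _).1 hf
    have h1 : Function.Bijective fun φ : A.unop.obj ⟶ powPresheaf => f.unop.hom ≫ φ := by
      have h2 : (fun φ : A.unop.obj ⟶ powPresheaf => f.unop.hom ≫ φ) =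
          powEquiv B.unop ∘ pow.map f ∘ (powEquiv A.unop).symm := by
        funext φ
        refine ((powEquiv B.unop).symm_apply_eq.1 ?_)
        exact (map_powEquiv_symm f.unop φ).symm
      rw [h2]
      exact (powEquiv _).bijective.comp (hf.comp (powEquiv _).symm.bijective)
    have h3 : IsIso ((ObjectProperty.ι (IsIndObject (C := FinPoset.{u}))).map f.unop) :=
      isIso_of_bijective (isFlat _) (isFlat _) f.unop.hom h1
    have : IsIso f.unop :=
      isIso_of_reflects_iso f.unop (ObjectProperty.ι (IsIndObject (C := FinPoset.{u})))
    exact (isIso_unop_iff f).1 this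

/-- The equalizer of a pair of morphisms of ind-objects. -/
def eqObj {A B : IndPoset.{u}} (f g : A ⟶ B) : IndPoset.{u} :=
  ⟨equalizerPresheaf f.hom g.hom, ((isFlat A).equalizer (isFlat B) f.hom g.hom).isIndObject⟩

/-- The inclusion of the equalizer of a pair of morphisms of ind-objects. -/
def eqι {A B : IndPoset.{u}} (f g : A ⟶ B) : eqObj f g ⟶ A :=
  ObjectProperty.homMk (equalizerIncl f.hom g.hom)

theorem eqι_condition {A B : IndPoset.{u}} (f g : A ⟶ B) : eqι f g ≫ f = eqι f g ≫ g :=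
  ObjectProperty.hom_ext _ (equalizerIncl_condition f.hom g.hom)

/-- The universal property of the equalizer, in the opposite category. -/
def eqIsColimit {A B : IndPoset.{u}ᵒᵖ} (f g : A ⟶ B) :
    IsColimit (Cofork.ofπ (f := f) (g := g) (eqι g.unop f.unop).op
      (congrArg Quiver.Hom.op (eqι_condition g.unop f.unop).symm)) :=
  Cofork.IsColimit.mk' _ fun s => by
    refine ⟨Quiver.Hom.op (ObjectProperty.homMk
      { app := fun P => TypeCat.ofHom fun a => ⟨s.π.unop.hom.app P a,
          ConcreteCategory.congr_hom
            (congrArg (fun k => NatTrans.app k.unop.hom P) s.condition.symm) a⟩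
        naturality := fun P Q k => by
          ext a
          exact Subtype.ext (NatTrans.naturality_apply s.π.unop.hom k a :) }), ?_, ?_⟩
    · rfl
    · intro m hm
      apply Quiver.Hom.unop_inj
      apply ObjectProperty.hom_ext
      ext P a
      exact Subtype.ext (ConcreteCategory.congr_hom
        (congrArg (fun k => NatTrans.app k.unop.hom P) hm) a)

/-- The functor `IndPoset.pow` turns equalizers of coreflexive pairs into split coequalizers. -/
noncomputable def isSplitCoequalizer {A B : IndPoset.{u}ᵒᵖ} (f g : A ⟶ B) (r : B ⟶ A)
    (hf : r ≫ f = 𝟙 B) (hg : r ≫ g = 𝟙 B) :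
    IsSplitCoequalizer (pow.map f) (pow.map g) (pow.map (eqι g.unop f.unop).op) where
  rightSection := TypeCat.ofHom fun φ => (powEquiv B.unop).symm
    (extendZero (isFlat A.unop) (powEquiv (eqObj g.unop f.unop) φ))
  -- The left section must split the bottom map, so the direct image is taken along `g.unop`; hence
  -- the order g, f in the equalizer.
  leftSection := TypeCat.ofHom fun ψ => (powEquiv A.unop).symm
    (directImage (isFlat A.unop) g.unop.hom r.unop.hom (powEquiv B.unop ψ))
  condition := by
    rw [← pow.map_comp, ← pow.map_comp]
    exact congrArg (fun k => pow.map (Quiver.Hom.op k)) (eqι_condition g.unop f.unop).symm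
  rightSection_π := by
    ext φ
    refine (map_powEquiv_symm (eqι g.unop f.unop) _).trans ((powEquiv _).symm_apply_eq.2 ?_)
    exact equalizerIncl_extendZero (isFlat A.unop) _
  leftSection_bottom := by
    ext ψ
    refine (map_powEquiv_symm g.unop _).trans ((powEquiv _).symm_apply_eq.2 ?_)
    exact comp_directImage (isFlat A.unop)
      (congrArg (fun k => InducedCategory.Hom.hom (Quiver.Hom.unop k)) hg) _
  leftSection_top := by
    ext ψ
    refine (map_powEquiv_symm f.unop _).trans (congrArg (powEquiv B.unop).symm ?_)
    refine (comp_directImage' (isFlat A.unop)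
      (congrArg (fun k => InducedCategory.Hom.hom (Quiver.Hom.unop k)) hf) _).trans ?_
    exact congrArg _ (powEquiv_map (eqι g.unop f.unop) ψ).symm

instance : HasReflexiveCoequalizers IndPoset.{u}ᵒᵖ where
  has_coeq _ _ f g _ := ⟨⟨⟨_, eqIsColimit f g⟩⟩⟩

theorem preservesColimit_pow {A B : IndPoset.{u}ᵒᵖ} (f g : A ⟶ B) [IsReflexivePair f g] :
    PreservesColimit (parallelPair f g) pow := by
  obtain ⟨r, hf, hg⟩ := IsReflexivePair.common_section f g
  exact preservesColimit_of_preserves_colimit_cocone (eqIsColimit f g)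
    ((isColimitMapCoconeCoforkEquiv _ _).symm (isSplitCoequalizer f g r hf hg).isCoequalizer)

end IndPoset

/-! ### Ind-completions and equivalences -/

section

variable {C : Type u} [Category.{v} C] {D : Type u'} [Category.{v} D] (e : C ≌ D)

/-- Precomposition of representable presheaves with an equivalence. -/
def yonedaPrecompIso :
    yoneda ⋙ (Functor.whiskeringLeft Cᵒᵖ Dᵒᵖ (Type v)).obj e.functor.op ≅ e.inverse ⋙ yoneda :=
  NatIso.ofComponents
    (fun Y => NatIso.ofComponents (fun X => (e.toAdjunction.homEquiv X.unop Y).toIso) fun f => by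
      ext g
      exact e.toAdjunction.homEquiv_naturality_left _ _) fun f => by
    ext X g
    exact e.toAdjunction.homEquiv_naturality_right _ _

/-- Precomposition preserves the filtered colimit and, along an equivalence, sends representables to
representables. -/
theorem isIndObject_precomp {A : Dᵒᵖ ⥤ Type v} (hA : IsIndObject A) :
    IsIndObject (e.functor.op ⋙ A) := by
  obtain ⟨⟨P⟩⟩ := hA
  exact ObjectProperty.prop_of_isColimit (P := IsIndObject (C := C))
    (isColimitOfPreserves ((Functor.whiskeringLeft Cᵒᵖ Dᵒᵖ (Type v)).obj e.functor.op)
      P.coconeIsColimit) fun i =>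
    ObjectProperty.prop_of_iso (IsIndObject (C := C)) ((yonedaPrecompIso e).symm.app (P.F.obj i))
      (isIndObject_yoneda _)

/-- Precomposition with an equivalence, as an equivalence between categories of ind-objects. -/
def indPresheafEquiv : ObjectProperty.FullSubcategory (IsIndObject (C := D)) ≌
    ObjectProperty.FullSubcategory (IsIndObject (C := C)) :=
  (e.op.congrLeft (E := Type v)).symm.congrFullSubcategory (by
    ext A
    refine ⟨fun h => ?_, isIndObject_precomp e⟩
    exact ObjectProperty.prop_of_iso (IsIndObject (C := D))
      ((e.op.congrLeft (E := Type v)).counitIso.app A) (isIndObject_precomp e.symm h))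

/-- The equivalence of Ind-completions induced by an equivalence. -/
noncomputable def indEquiv : Ind D ≌ Ind C :=
  (Ind.equivalence D).trans ((indPresheafEquiv e).trans (Ind.equivalence C).symm)

/-- The equivalence of Ind-completions is given by precomposition. -/
noncomputable def indEquivInclusion : (indEquiv e).functor ⋙ Ind.inclusion C ≅
    Ind.inclusion D ⋙ (Functor.whiskeringLeft Cᵒᵖ Dᵒᵖ (Type v)).obj e.functor.op :=
  Functor.isoWhiskerLeft ((Ind.equivalence D).functor ⋙ (indPresheafEquiv e).functor)
    (Functor.isoWhiskerRight (Ind.equivalence C).counitIso (ObjectProperty.ι _))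

/-- The equivalence of Ind-completions extends the given equivalence. -/
noncomputable def yonedaIndEquiv :
    Ind.yoneda ⋙ (indEquiv e).functor ≅ e.inverse ⋙ Ind.yoneda :=
  (Ind.inclusion.fullyFaithful.whiskeringRight D).preimageIso <|
    Functor.isoWhiskerLeft Ind.yoneda (indEquivInclusion e) ≪≫
    (Functor.isoWhiskerRight Ind.yonedaCompInclusion
      ((Functor.whiskeringLeft Cᵒᵖ Dᵒᵖ (Type v)).obj e.functor.op) ≪≫ yonedaPrecompIso e :) ≪≫
    Functor.isoWhiskerLeft e.inverse Ind.yonedaCompInclusion.symm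

/-- The equivalence of Pro-completions induced by an equivalence. -/
noncomputable def proEquiv : Pro C ≌ Pro D := (indEquiv e.op.symm).op

/-- The equivalence of Pro-completions extends the given equivalence. -/
noncomputable def embeddingProEquiv :
    Pro.embedding C ⋙ (proEquiv e).functor ≅ e.functor ⋙ Pro.embedding D :=
  NatIso.ofComponents (fun X => ((yonedaIndEquiv e.op.symm).app (op X)).symm.op) fun {X Y} f => by
    apply Quiver.Hom.unop_inj
    exact ((yonedaIndEquiv e.op.symm).inv.naturality f.op).symm

/-- The extension of a functor `W` to the Pro-completion agrees with `W` on representables. -/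
theorem Pro.nonempty_extend_equiv (W : C ⥤ Type v) (X : C) :
    Nonempty ((Pro.extend W).obj ((Pro.embedding C).obj X) ≃ W.obj X) := by
  let i := (Ind.yonedaCompInclusion (C := Cᵒᵖ)).app (op X)
  exact ⟨(equivShrink ((Pro.homFunctor W).obj ((Pro.embedding C).obj X))).symm.trans
    ((i.homCongr (Iso.refl _)).trans yonedaEquiv)⟩

end

/-! ### The main theorem -/

/-- Finite posets are dual to finite `Grz`-algebras. -/
noncomputable def grzDuality : FinPoset.{u} ≌ FinGrz.{u}ᵒᵖ :=
  FinPoset.powerset.{u}.asEquivalence.rightOp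

/-- Profinite `Grz`-algebras are dual to ind-objects in finite posets. -/
noncomputable def proGrzDuality : Pro FinGrz.{u} ≌ IndPoset.{u}ᵒᵖ :=
  ((Ind.equivalence FinGrz.{u}ᵒᵖ).trans (indPresheafEquiv grzDuality)).op

/-- The forgetful functor of profinite `Grz`-algebras, in terms of ind-objects in finite posets. -/
noncomputable def extendForgetIso :
    Pro.extend FinGrz.forget.{u} ≅ proGrzDuality.functor ⋙ IndPoset.pow :=
  NatIso.ofComponents (fun X =>
    ((equivShrink ((Pro.homFunctor FinGrz.forget).obj X)).symm.trans
      -- `powPresheaf` is the forgetful functor precomposed with the duality, and precomposition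
      -- with an equivalence is fully faithful.
      (((Functor.FullyFaithful.ofFullyFaithful
        (grzDuality.{u}.op.congrLeft (E := Type u)).inverse).homEquiv).trans
          (IndPoset.powEquiv (proGrzDuality.functor.obj X).unop).symm)).toIso) fun {X Y} f => by
    ext x
    refine Eq.trans ?_ (IndPoset.map_powEquiv_symm (proGrzDuality.functor.map f).unop _).symm
    refine congrArg (IndPoset.powEquiv (proGrzDuality.functor.obj Y).unop).symm ?_
    exact congrArg ((grzDuality.{u}.op.congrLeft (E := Type u)).inverse.map)
      ((equivShrink ((Pro.homFunctor FinGrz.forget).obj Y)).symm_apply_apply _)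

/-- Reflexive pairs, their coequalizers and the preservation of these are transported along L, so
the monadicity theorem applies to V itself. -/
theorem nonempty_monadicRightAdjoint {D : Type u'} [Category.{u} D] (L : D ⥤ IndPoset.{u}ᵒᵖ)
    [L.IsEquivalence] (V : D ⥤ Type u) (i : V ≅ L ⋙ IndPoset.pow) :
    Nonempty (MonadicRightAdjoint V) := by
  have hpair {A B : D} (f g : A ⟶ B) [IsReflexivePair f g] :
      IsReflexivePair (L.map f) (L.map g) := by
    obtain ⟨s, hf, hg⟩ := IsReflexivePair.common_section f g
    exact IsReflexivePair.mk' (L.map s) (by rw [← L.map_comp, hf, L.map_id])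
      (by rw [← L.map_comp, hg, L.map_id])
  have : HasReflexiveCoequalizers D :=
    { has_coeq := fun A B f g _ => by
        have := hpair f g
        have : HasColimit (parallelPair ((parallelPair f g ⋙ L).map .left)
            ((parallelPair f g ⋙ L).map .right)) :=
          HasReflexiveCoequalizers.has_coeq (L.map f) (L.map g)
        have : HasColimit (parallelPair f g ⋙ L) :=
          hasColimit_of_iso (diagramIsoParallelPair (parallelPair f g ⋙ L))
        exact Adjunction.hasColimit_of_comp_equivalence _ L }
  have : Monad.PreservesColimitOfIsReflexivePair V :=
    { out := fun A B f g _ => by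
        have := hpair f g
        have : PreservesColimit (parallelPair ((parallelPair f g ⋙ L).map .left)
            ((parallelPair f g ⋙ L).map .right)) IndPoset.pow :=
          IndPoset.preservesColimit_pow (L.map f) (L.map g)
        have : PreservesColimit (parallelPair f g ⋙ L) IndPoset.pow :=
          preservesColimit_of_iso_diagram _ (diagramIsoParallelPair (parallelPair f g ⋙ L)).symm
        exact preservesColimit_of_natIso _ i.symm }
  have : V.IsRightAdjoint := Functor.isRightAdjoint_of_iso i.symm
  have : V.ReflectsIsomorphisms := reflectsIsomorphisms_of_iso i.symm
  exact ⟨Monad.monadicOfHasPreservesReflexiveCoequalizersOfReflectsIsomorphisms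
    (Adjunction.ofIsRightAdjoint V)⟩

/-- The chain with two elements. -/
def twoChain : FinPoset.{u} where
  obj := ⟨ULift.{u} Bool, fun a b => a.down ≤ b.down⟩
  property :=
    { finite := inferInstanceAs (Finite (ULift.{u} Bool))
      refl := fun p => le_refl p.down
      trans := fun _ _ _ h h' => le_trans h h'
      antisymm := fun p q h h' => ULift.ext p q (le_antisymm h h') }

/-- A bijection followed by the inclusion of upsets among subsets would be an injective self-map of
a finite set, hence surjective; but the singleton of the bottom element is not an upset. -/
theorem twoChain_isEmpty_equiv :
    IsEmpty (Pow twoChain.{u}.obj ≃ GenSub twoChain.{u}.obj) := by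
  refine ⟨fun e => ?_⟩
  have : Finite twoChain.{u}.obj.carrier := twoChain.finite
  have : Finite (Pow twoChain.{u}.obj) := inferInstanceAs (Finite (Set twoChain.{u}.obj.carrier))
  let c (U : GenSub twoChain.{u}.obj) : Pow twoChain.{u}.obj := U.carrier
  have hc : Function.Injective c := fun _ _ h => GenSub.ext h
  obtain ⟨X, hX⟩ := Finite.surjective_of_injective (hc.comp e.injective)
    (Pow.single (P := twoChain.{u}.obj) ⟨false⟩)
  have h1 : (⟨true⟩ : ULift.{u} Bool) ∈ c (e X) :=
    (e X).closed ⟨false⟩ ⟨true⟩ (by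
      change (⟨false⟩ : ULift.{u} Bool) ∈ c (e X)
      rw [show c (e X) = _ from hX]
      rfl) (Bool.false_le _)
  rw [show c (e X) = _ from hX] at h1
  have h2 : (⟨true⟩ : ULift.{u} Bool) = ⟨false⟩ := h1
  simp at h2

/-- Finite Heyting algebras are equivalent to finite `Grz`-algebras. -/
noncomputable def heytGrz : FinHeyt.{u} ≌ FinGrz.{u} :=
  FinPoset.upsets.{u}.asEquivalence.symm.trans FinPoset.powerset.{u}.asEquivalence

/-- The equivalence of finite Heyting algebras and finite `Grz`-algebras exchanges upsets and
powersets. -/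
noncomputable def upsetsHeytGrz : FinPoset.upsets.{u} ⋙ heytGrz.functor ≅ FinPoset.powerset.{u} :=
  Functor.isoWhiskerRight FinPoset.upsets.{u}.asEquivalence.unitIso.symm FinPoset.powerset.{u}

theorem isEmpty_forget_iso :
    IsEmpty ((proEquiv heytGrz.{u}).functor ⋙ Pro.extend FinGrz.forget.{u} ≅
      Pro.extend FinHeyt.forget.{u}) := by
  refine ⟨fun i => ?_⟩
  let U := FinPoset.upsets.{u}.obj (op twoChain)
  obtain ⟨e₁⟩ := Pro.nonempty_extend_equiv FinHeyt.forget.{u} U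
  obtain ⟨e₂⟩ := Pro.nonempty_extend_equiv FinGrz.forget.{u} (heytGrz.functor.obj U)
  have e₃ := ((Pro.extend FinGrz.forget.{u}).mapIso
    ((embeddingProEquiv heytGrz.{u}).app U)).toEquiv
  have e₄ := (i.app ((Pro.embedding FinHeyt.{u}).obj U)).toEquiv
  have e₅ := (FinGrz.forget.{u}.mapIso (upsetsHeytGrz.app (op twoChain))).toEquiv
  exact twoChain_isEmpty_equiv.false
    (e₅.symm.trans (e₂.symm.trans (e₃.symm.trans (e₄.trans e₁))))

end ProfiniteHeyting

theorem mainTheorem7 :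
    ProfiniteHeyting.FinPoset.upsets.{u}.IsEquivalence ∧
    ProfiniteHeyting.FinPoset.powerset.{u}.IsEquivalence ∧
    ∃ (E : ProfiniteHeyting.FinHeyt.{u} ≌ ProfiniteHeyting.FinGrz.{u})
      (G : ProfiniteHeyting.Pro ProfiniteHeyting.FinHeyt.{u} ≌
        ProfiniteHeyting.Pro ProfiniteHeyting.FinGrz.{u}),
      Nonempty (ProfiniteHeyting.FinPoset.upsets.{u} ⋙ E.functor ≅
        ProfiniteHeyting.FinPoset.powerset.{u}) ∧
      Nonempty (ProfiniteHeyting.Pro.embedding ProfiniteHeyting.FinHeyt.{u} ⋙ G.functor ≅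
        E.functor ⋙ ProfiniteHeyting.Pro.embedding ProfiniteHeyting.FinGrz.{u}) ∧
      Nonempty (MonadicRightAdjoint
        (G.functor ⋙ ProfiniteHeyting.Pro.extend ProfiniteHeyting.FinGrz.forget.{u})) ∧
      IsEmpty (G.functor ⋙ ProfiniteHeyting.Pro.extend ProfiniteHeyting.FinGrz.forget.{u} ≅
        ProfiniteHeyting.Pro.extend ProfiniteHeyting.FinHeyt.forget.{u}) :=
  ⟨inferInstance, inferInstance, ProfiniteHeyting.heytGrz,
    ProfiniteHeyting.proEquiv ProfiniteHeyting.heytGrz, ⟨ProfiniteHeyting.upsetsHeytGrz⟩,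
    ⟨ProfiniteHeyting.embeddingProEquiv _⟩,
    ProfiniteHeyting.nonempty_monadicRightAdjoint
      ((ProfiniteHeyting.proEquiv ProfiniteHeyting.heytGrz).functor ⋙
        ProfiniteHeyting.proGrzDuality.functor) _
      (Functor.isoWhiskerLeft _ ProfiniteHeyting.extendForgetIso),
    ProfiniteHeyting.isEmpty_forget_iso⟩
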